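/- **Setting.** Consider metric uncapacitated facility location: finite sets $\mathcal F$ (facilities) and $\mathcal C$ (clients), opening costs $f_i\ge 0$, and connection costs $c_{ij}$ that are distances between facilities and clients in a (pseudo)metric space. Let $(x^*,y^*)$ be any feasible (for example, an optimal) solution of the LP relaxation: $\sum_i x^*_{ij}=1$, $0\le x^*_{ij}\le y^*_i$. Put $F^*_i=f_iy^*_i$, $C^*_j=\sum_i c_{ij}x^*_{ij}$, $F^*=\sum_iF^*_i$, $C^*=\sum_jC^*_j$. **The algorithm $CS(\gamma)$ (Chudak–Shmoys), started with $(x^*,y^*)$.** (1) Put $\tilde y=\gamma y^*$ and reassign every client completely to its closest facilities: for some ordering of the facilities by nondecreasing distance to $j$, if $i'$ is later than $i$ and $\tilde x_{ij}<\tilde y_i$, then $\tilde x_{i'j}=0$; here $0\le\tilde x_{ij}\le\tilde y_i$ and $\sum_i\tilde x_{ij}=1$. (2) Split each facility $i$ into finitely many copies $k$, at the same location and with the same opening cost, with opening values $0\le\bar y_k\le 1$ of total $\tilde y_i$, and divide the assignments accordingly (the values $\bar x_{kj}$ of the copies $k$ of $i$ have total $\tilde x_{ij}$), so that $\bar x_{kj}\in\{0,\bar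 y_k\}$ for every copy $k$ and client $j$. (3) As long as clients remain, choose a remaining client $j$ that minimizes $\sum_k c_{kj}\bar x_{kj}+\max\{c_{kj}:\bar x_{kj}>0\}$ as a cluster center; its cluster is $\{k:\bar x_{kj}>0\}$. Remove $j$ and all clients that share a copy with $j$ (i.e. are served by a common copy). (4) Independently, open exactly one copy in each cluster, copy $k$ with probability $\bar y_k$, and open each copy $k$ that is in no cluster with probability $\bar y_k$. (5) Connect each client to the closest open facility. **Theorem.** Let $1\le\gamma<2$ and put $$\lambda_\gamma=\max\left\{1+2e^{-\gamma},\ \frac{e^{-1}+e^{-\gamma}}{1-\frac1\gamma}\right\},$$ where $\lambda_1=+\infty$ (with the convention $\infty\cdot 0=0$). For every such instance and every feasible $(x^*,y^*)$, the algorithm $CS(\gamma)$ can be carried out, and however the choices (orderings, splitting, ties) in steps (1)–(3) are made, the following holds. * For every facility $i$, the expected cost of opening $i$, where $f_i$ is paid for each open copy of $i$, equals $\gamma F^*_i$. * For every client $j$, the expected connection cost is at most $\lambda_\gamma C^*_j$. * Consequently, the solution of the original instance that opens every facility with at least one open copy (paying $f_i$ once) has expected total opening cost at most $\gamma F^*$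 and expected total connection cost at most $\lambda_\gamma C^*$; that is, $CS(\gamma)$ is a $(\gamma,\lambda_\gamma)$ bifactor approximation with respect to the LP solution it starts from. -/

import Mathlib

open scoped ENNReal

noncomputable section

namespace UFL

/-- An instance of metric uncapacitated facility location with facilities `F` and clients `C`:
nonnegative opening costs, and connection costs that are distances in a (pseudo)metric space.
Distinct facilities and clients may share a location. -/
structure MetricInstance (F C X : Type*) [PseudoMetricSpace X] where
  /-- the opening cost of a facility -/
  openCost : F → ℝ
  openCost_nonneg : ∀ i, 0 ≤ openCost i
  /-- the location of a facility -/
  facilityLoc : F → X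
  /-- the location of a client -/
  clientLoc : C → X

/-- The feasible region of the LP relaxation: `x i j` is the amount to which client `j` is assigned
to facility `i`, and `y i` the amount to which facility `i` is opened. -/
structure IsFeasible {F C : Type*} [Fintype F] (x : F → C → ℝ) (y : F → ℝ) : Prop where
  sum_eq_one : ∀ j, ∑ i, x i j = 1
  le_open : ∀ i j, x i j ≤ y i
  assign_nonneg : ∀ i j, 0 ≤ x i j
  open_nonneg : ∀ i, 0 ≤ y i

/-- The greedy clustering procedure. `IsGreedyClustering score share R L` says that, starting with
the set `R` of unprocessed clients, the procedure may pick the cluster centers `L`, in this order: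
each time a remaining client of smallest score becomes a center, and it is removed together with
every client that shares a facility with it, until no client remains. -/
inductive IsGreedyClustering {C : Type*} (score : C → ℝ) (share : C → C → Prop) :
    Set C → List C → Prop
  | done : IsGreedyClustering score share ∅ []
  | pick (R : Set C) (j : C) (L : List C) (hj : j ∈ R) (hmin : ∀ j' ∈ R, score j ≤ score j')
      (hrest : IsGreedyClustering score share {j' ∈ R | j' ≠ j ∧ ¬ share j j'} L) :
      IsGreedyClustering score share R (j :: L)

namespace MetricInstance

variable {F C X : Type*} [Fintype F] [Fintype C] [PseudoMetricSpace X]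

/-- The cost `c i j` of connecting client `j` to facility `i`. -/
def conn (I : MetricInstance F C X) (i : F) (j : C) : ℝ :=
  dist (I.facilityLoc i) (I.clientLoc j)

/-- The fractional opening cost of facility `i`. -/
def fracOpen (I : MetricInstance F C X) (y : F → ℝ) (i : F) : ℝ := I.openCost i * y i

/-- The fractional connection cost of client `j`. -/
def fracConn (I : MetricInstance F C X) (x : F → C → ℝ) (j : C) : ℝ := ∑ i, I.conn i j * x i j

/-- The opening cost of a set `S` of facilities. -/
def solOpen (I : MetricInstance F C X) (S : Finset F) : ℝ := ∑ i ∈ S, I.openCost i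

/-- The distance of client `j` to the closest facility of a (nonempty) set `S`. -/
def solConn (I : MetricInstance F C X) (S : Finset F) (j : C) : ℝ :=
  sInf ((fun i => I.conn i j) '' (S : Set F))

/-- `xt` assigns every client completely to its closest facilities with respect to the opening
values `yt`: for some ordering of the facilities by nondecreasing distance to `j`, client `j` uses
the facilities in this order, and turns to a later one only if all earlier ones are used up. -/
structure IsClosestAssignment (I : MetricInstance F C X) (yt : F → ℝ) (xt : F → C → ℝ) :
    Prop where
  nonneg : ∀ i j, 0 ≤ xt i j
  le_open : ∀ i j, xt i j ≤ yt i
  sum_eq_one : ∀ j, ∑ i, xt i j = 1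
  closest : ∀ j, ∃ r : F ≃ Fin (Fintype.card F),
    (∀ i i', r i < r i' → I.conn i j ≤ I.conn i' j) ∧
    (∀ i i', r i < r i' → xt i j < yt i → xt i' j = 0)

end MetricInstance

open Classical in
/-- `(xb, yb)` is a complete solution, on the set `K` of copies of facilities (`k` being a copy of
`orig k`), obtained from `(xt, yt)` by splitting facilities: every client uses each copy either
fully or not at all. Copies are opened to an amount of at most one. -/
structure IsCompleteSplitting {F C K : Type*} [Fintype K] (yt : F → ℝ) (xt : F → C → ℝ)
    (orig : K → F) (yb : K → ℝ) (xb : K → C → ℝ) : Prop where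
  nonneg : ∀ k, 0 ≤ yb k
  le_one : ∀ k, yb k ≤ 1
  sum_open : ∀ i, ∑ k with orig k = i, yb k = yt i
  sum_assign : ∀ i j, ∑ k with orig k = i, xb k j = xt i j
  complete : ∀ k j, xb k j = 0 ∨ xb k j = yb k

/-- The deterministic part of a run of the algorithm `CS(γ)` that starts with the fractional opening
values `y`: scaling by `γ`, reassignment to closest facilities, splitting of the facilities into a
finite set `K` of copies, and clustering. -/
structure CSRun {F C X : Type*} [Fintype F] [Fintype C] [PseudoMetricSpace X]
    (I : MetricInstance F C X) (γ : ℝ) (y : F → ℝ) (K : Type*) [Fintype K] where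
  /-- the assignment after scaling -/
  xt : F → C → ℝ
  xt_closest : I.IsClosestAssignment (fun i => γ * y i) xt
  /-- the facility of which `k` is a copy -/
  orig : K → F
  /-- the opening values of the complete solution -/
  yb : K → ℝ
  /-- the assignment of the complete solution -/
  xb : K → C → ℝ
  splitting : IsCompleteSplitting (fun i => γ * y i) xt orig yb xb
  /-- the cluster centers, in the order in which they are picked -/
  centers : List C
  /-- The score of a client is its average distance plus its maximum distance to the copies that
  serve it. -/
  clustering : IsGreedyClustering
    (fun j => ∑ k, I.conn (orig k) j * xb k j +
      sSup ((fun k => I.conn (orig k) j) '' {k | 0 < xb k j}))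
    (fun j j' => ∃ k, 0 < xb k j ∧ 0 < xb k j') Set.univ centers

namespace CSRun

variable {F C X K : Type*} [Fintype F] [Fintype C] [PseudoMetricSpace X] [Fintype K]
  {I : MetricInstance F C X} {γ : ℝ} {y : F → ℝ}

/-- The outcome of the random choices: one copy for each cluster, and a coin for each copy. -/
abbrev Outcome (R : CSRun I γ y K) : Type _ := (Fin R.centers.length → K) × (K → Bool)

/-- Copy `k` belongs to the `t`-th cluster, i.e. it serves the center of this cluster. -/
def InCluster (R : CSRun I γ y K) (t : Fin R.centers.length) (k : K) : Prop :=
  0 < R.xb k (R.centers.get t)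

open Classical in
/-- The probability of an outcome. All choices are independent; a cluster chooses its copy `k` with
probability `yb k`, and the coin of copy `k` shows `true` with probability `yb k`. -/
def prob (R : CSRun I γ y K) (ω : R.Outcome) : ℝ :=
  (∏ t, if R.InCluster t (ω.1 t) then R.yb (ω.1 t) else 0) *
    ∏ k, if ω.2 k = true then R.yb k else 1 - R.yb k

/-- Copy `k` is opened: it is the choice of some cluster, or it belongs to no cluster and its coin
shows `true`. -/
def IsOpened (R : CSRun I γ y K) (ω : R.Outcome) (k : K) : Prop :=
  (∃ t, ω.1 t = k) ∨ ((∀ t, ¬ R.InCluster t k) ∧ ω.2 k = true)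

open Classical in
/-- Expectation over the random choices. -/
def expect (R : CSRun I γ y K) (Z : R.Outcome → ℝ) : ℝ := ∑ ω, R.prob ω * Z ω

open Classical in
/-- The cost of opening facility `i`, paid for each opened copy of `i`. -/
def openCost (R : CSRun I γ y K) (ω : R.Outcome) (i : F) : ℝ :=
  ∑ k with R.orig k = i ∧ R.IsOpened ω k, I.openCost i

open Classical in
/-- The solution of the original instance: the facilities with at least one opened copy. -/
def solution (R : CSRun I γ y K) (ω : R.Outcome) : Finset F :=
  {i | ∃ k, R.orig k = i ∧ R.IsOpened ω k}

/-- The connection cost of client `j`: the distance to the closest opened facility. -/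
def connCost (R : CSRun I γ y K) (ω : R.Outcome) (j : C) : ℝ := I.solConn (R.solution ω) j

end CSRun

/-- `max {1 + 2 e^(-γ), (e^(-1) + e^(-γ)) / (1 - 1/γ)}`, which is infinite for `γ = 1`. -/
def connFactor (γ : ℝ) : ℝ≥0∞ :=
  max (ENNReal.ofReal (1 + 2 * Real.exp (-γ)))
    (ENNReal.ofReal (Real.exp (-1) + Real.exp (-γ)) / ENNReal.ofReal (1 - 1 / γ))

namespace CSRun

variable {F C X K : Type*} [Fintype F] [Fintype C] [PseudoMetricSpace X] [Fintype K]
  {I : MetricInstance F C X} {γ : ℝ} {y : F → ℝ}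

/-- Probabilities are nonnegative. -/
theorem prob_nonneg (R : CSRun I γ y K) (ω : R.Outcome) : 0 ≤ R.prob ω := by
  classical
  refine mul_nonneg (Finset.prod_nonneg fun t _ => ?_) (Finset.prod_nonneg fun k _ => ?_)
  · split_ifs
    exacts [R.splitting.nonneg _, le_rfl]
  · split_ifs
    exacts [R.splitting.nonneg _, sub_nonneg.2 (R.splitting.le_one _)]

/-- The probabilities of the outcomes sum to one. -/
theorem expect_one (R : CSRun I γ y K) : R.expect (fun _ => 1) = 1 := by
  classical
  have hxb : ∀ k j, (if 0 < R.xb k j then R.yb k else 0) = R.xb k j := by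
    intro k j
    have h0 := R.splitting.nonneg k
    rcases R.splitting.complete k j with h | h
    · simp [h]
    · rw [h]
      split_ifs with h1
      · rfl
      · linarith
  have hsum : ∀ j, ∑ k, R.xb k j = 1 := by
    intro j
    rw [← R.xt_closest.sum_eq_one j, ← Finset.sum_fiberwise Finset.univ R.orig]
    exact Finset.sum_congr rfl fun i _ => by convert R.splitting.sum_assign i j
  have h1 : ∑ g : Fin R.centers.length → K,
      ∏ t, (if R.InCluster t (g t) then R.yb (g t) else 0) = 1 := by
    rw [← Fintype.prod_sum (fun t k => if R.InCluster t k then R.yb k else 0)]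
    refine Finset.prod_eq_one fun t _ => ?_
    rw [← hsum (R.centers.get t)]
    exact Finset.sum_congr rfl fun k _ => by
      rw [← hxb k (R.centers.get t)]; unfold InCluster; congr
  have h2 : ∑ b : K → Bool, ∏ k, (if b k = true then R.yb k else 1 - R.yb k) = 1 := by
    rw [← Fintype.prod_sum (fun k (b : Bool) => if b = true then R.yb k else 1 - R.yb k)]
    exact Finset.prod_eq_one fun k _ => by simp
  have h3 : (∑ g : Fin R.centers.length → K,
      ∏ t, (if R.InCluster t (g t) then R.yb (g t) else 0)) *
      (∑ b : K → Bool, ∏ k, (if b k = true then R.yb k else 1 - R.yb k)) = 1 := by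
    rw [h1, h2, one_mul]
  rw [Finset.sum_mul_sum, ← Fintype.sum_prod_type'] at h3
  refine Eq.trans ?_ h3
  simp only [expect, prob, mul_one]

end CSRun

end UFL

end

open scoped ENNReal

noncomputable section

namespace UFL

/-! Opening costs are exact: clusters are pairwise disjoint, so copy `k` is opened with probability
`yb k`, and the copies of a facility have total value `γ * y i`.

For the connection cost of a client `j`, extend the copies serving `j` (value 1, average distance
`A`, maximum `m`) to the nearest copies of total value `γ`, which end at distance `ρ`; let `D ≥ m`
be the average distance of the additional value `γ - 1`. An exchange argument gives `A + (γ - 1) D ≤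
γ C_j`. Independence and `1 - p ≤ e^(-p)` show that no copy within `r` is open with probability at
most the exponential of minus the value available within `r`. Replacing the exponential by chords
turns this into weights `1 - e^(-1)` on `A` and `e^(-1) - e^(-γ)` on `D`, and `e^(-γ)` remains for a
fallback.

The fallback is the cluster of a center `j'` that shares a copy with `j` and has no larger score;
almost surely one of its copies is open. With `a'` and `m'` the average and maximum distance of
`j'`, the part of its cluster outside the nearest mass has average distance at most `D + m' + a'`
from `j` (`sum_residual_mul_le`, where `γ ≤ 2` enters), and `m' + a' ≤ m + A ≤ D + A` by the greedy
rule. If `ρ` exceeds `D + m' + a'`, that part is empty and `tail_le_of_subset` takes over; otherwise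
`tail_le_of_residual` applies. Tails are compared for every `r` and integrated by
`sum_mul_le_sum_mul_of_step`.

The result is `(1 + 2 e^(-γ)) A + (e^(-1) + e^(-γ)) (D - A)`, to be compared with `A + (1 - 1/γ) (D
- A) ≤ C_j`. For `γ = 1` only clients with `C_j = 0` need an argument; they pay nothing. -/

/-! ### Existence of a run: clustering, closest assignment, splitting. -/

theorem exists_isGreedyClustering {C : Type*} [Finite C] (score : C → ℝ) (share : C → C → Prop)
    (R : Set C) : ∃ L, IsGreedyClustering score share R L := by
  induction hn : R.ncard using Nat.strong_induction_on generalizing R with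
  | _ n ih =>
    rcases R.eq_empty_or_nonempty with rfl | hR
    · exact ⟨[], .done⟩
    obtain ⟨j, hj, hmin⟩ := Set.exists_min_image R score (Set.toFinite R) hR
    have hlt : {j' ∈ R | j' ≠ j ∧ ¬ share j j'}.ncard < n := by
      rw [← hn]
      refine Set.ncard_lt_ncard ?_ (Set.toFinite R)
      exact ⟨fun a ha => ha.1, fun h => (h hj).2.1 rfl⟩
    obtain ⟨L, hL⟩ := ih _ hlt _ rfl
    exact ⟨j :: L, .pick R j L hj hmin hL⟩

/-- Filling up the entries of `a` from the left until a total of one is reached. -/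
theorem exists_prefix_fill (n : ℕ) (a : Fin n → ℝ) (ha : ∀ m, 0 ≤ a m) (hsum : 1 ≤ ∑ m, a m) :
    ∃ b : Fin n → ℝ, (∀ m, 0 ≤ b m) ∧ (∀ m, b m ≤ a m) ∧ ∑ m, b m = 1 ∧
      ∀ m m', m < m' → b m < a m → b m' = 0 := by
  set a' : ℕ → ℝ := fun m => if h : m < n then a ⟨m, h⟩ else 0 with ha'
  have ha'n : ∀ m, 0 ≤ a' m := fun m => by
    simp only [ha']; split_ifs <;> simp [ha]
  have haa : ∀ m : Fin n, a' m = a m := fun m => by simp [ha']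
  set P : ℕ → ℝ := fun m => ∑ l ∈ Finset.range m, a' l with hP
  have hPs : ∀ m, P (m + 1) = P m + a' m := fun m => Finset.sum_range_succ _ _
  have hPm : Monotone P := monotone_nat_of_le_succ fun m => by
    rw [hPs]; linarith [ha'n m]
  have hPn : 1 ≤ P n := by
    rw [hP]; dsimp only
    rw [← Fin.sum_univ_eq_sum_range a' n]
    simpa [haa] using hsum
  -- Entry `m` receives the part of the interval from `P m` to `P (m + 1)` that lies below 1, so the
  -- total telescopes.
  refine ⟨fun m => min 1 (P (m + 1)) - min 1 (P m), fun m => ?_, fun m => ?_, ?_,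
    fun m m' hmm h => ?_⟩
  · exact sub_nonneg.2 (min_le_min le_rfl (hPm (Nat.le_succ _)))
  · rw [← haa m]
    change min 1 (P (m + 1)) - min 1 (P m) ≤ a' m
    rw [hPs]
    have := ha'n m
    rcases le_total 1 (P m) with h | h
    · rw [min_eq_left h, min_eq_left (by linarith)]; linarith
    · rw [min_eq_right h]; linarith [min_le_right 1 (P m + a' m)]
  · rw [Fin.sum_univ_eq_sum_range (fun m => min 1 (P (m + 1)) - min 1 (P m)) n,
      Finset.sum_range_sub (fun m => min 1 (P m)), min_eq_left hPn]
    simp [hP]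
  · have h1 : 1 ≤ P (m + 1) := by
      by_contra hc
      push Not at hc
      have h2 := hPm (Nat.le_succ (m : ℕ))
      rw [← haa m] at h
      change min 1 (P (m + 1)) - min 1 (P m) < a' m at h
      simp only [Nat.succ_eq_add_one] at h2
      rw [min_eq_right hc.le, min_eq_right (by linarith), hPs] at h
      linarith
    have h2 : P (m + 1) ≤ P m' := hPm (by exact hmm)
    have h3 : P (m + 1) ≤ P (m' + 1) := h2.trans (hPm (Nat.le_succ _))
    show min 1 (P (m' + 1)) - min 1 (P m') = 0
    rw [min_eq_left (by linarith), min_eq_left (by linarith), sub_self]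

theorem exists_equiv_fin_monotone {F : Type*} [Fintype F] (d : F → ℝ) :
    ∃ r : F ≃ Fin (Fintype.card F), ∀ i i', r i < r i' → d i ≤ d i' := by
  let e := Fintype.equivFin F
  let s := Tuple.sort (d ∘ e.symm)
  refine ⟨e.trans s.symm, fun i i' h => ?_⟩
  have := Tuple.monotone_sort (d ∘ e.symm) h.le
  simpa [s] using this

theorem MetricInstance.exists_isClosestAssignment {F C X : Type*} [Fintype F]
    [PseudoMetricSpace X] (I : MetricInstance F C X) (yt : F → ℝ) (hy : ∀ i, 0 ≤ yt i)
    (hsum : Nonempty C → 1 ≤ ∑ i, yt i) : ∃ xt, I.IsClosestAssignment yt xt := by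
  have key : ∀ j : C, ∃ b : F → ℝ, (∀ i, 0 ≤ b i) ∧ (∀ i, b i ≤ yt i) ∧ ∑ i, b i = 1 ∧
      ∃ r : F ≃ Fin (Fintype.card F),
        (∀ i i', r i < r i' → I.conn i j ≤ I.conn i' j) ∧
        (∀ i i', r i < r i' → b i < yt i → b i' = 0) := by
    intro j
    obtain ⟨r, hr⟩ := exists_equiv_fin_monotone fun i => I.conn i j
    obtain ⟨b, h0, h1, h2, h3⟩ := exists_prefix_fill _ (yt ∘ r.symm) (fun m => hy _)
      ((hsum ⟨j⟩).trans_eq (Equiv.sum_comp r.symm yt).symm)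
    refine ⟨b ∘ r, fun i => h0 _, fun i => by simpa using h1 (r i), ?_, r, hr, fun i i' h h' => ?_⟩
    · exact (Equiv.sum_comp r b).trans h2
    · exact h3 (r i) (r i') h (by simpa using h')
  choose b h0 h1 h2 h3 using key
  exact ⟨fun i j => b j i, fun i j => h0 j i, fun i j => h1 j i, fun j => h2 j, h3⟩

/-- A subdivision of an interval `[0, b n]` into pieces of length at most one that has all points of
`S` among its breakpoints. -/
theorem exists_breakpoints (S : Finset ℝ) (hS : ∀ s ∈ S, 0 ≤ s) :
    ∃ (n : ℕ) (b : ℕ → ℝ), b 0 = 0 ∧ (∀ m < n, b m ≤ b (m + 1)) ∧ (∀ m < n, b (m + 1) ≤ b m + 1) ∧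
      (∀ s ∈ S, s ≤ b n) ∧ ∀ s ∈ S, ∀ m < n, s ≤ b m ∨ b (m + 1) ≤ s := by
  classical
  obtain ⟨N, hN⟩ : ∃ N : ℕ, ∀ s ∈ S, s ≤ N := by
    obtain ⟨M, hM⟩ := S.bddAbove
    obtain ⟨N, hN⟩ := exists_nat_ge M
    exact ⟨N, fun s hs => (hM hs).trans hN⟩
  -- The integers are added as breakpoints to keep every piece at length at most one; they also
  -- supply the breakpoint 0.
  set T : Finset ℝ := S ∪ (Finset.range (N + 1)).image (fun m : ℕ => (m : ℝ)) with hT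
  have hST : S ⊆ T := Finset.subset_union_left
  have hnat : ∀ m ≤ N, (m : ℝ) ∈ T := fun m hm =>
    Finset.mem_union_right _ (Finset.mem_image_of_mem _ (Finset.mem_range.2 (by omega)))
  have hT0 : ∀ s ∈ T, 0 ≤ s := by
    intro s hs
    rcases Finset.mem_union.1 hs with h | h
    · exact hS s h
    · obtain ⟨m, -, rfl⟩ := Finset.mem_image.1 h
      positivity
  have hTN : ∀ s ∈ T, s ≤ N := by
    intro s hs
    rcases Finset.mem_union.1 hs with h | h
    · exact hN s h
    · obtain ⟨m, hm, rfl⟩ := Finset.mem_image.1 h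
      exact_mod_cast Nat.lt_succ_iff.1 (Finset.mem_range.1 hm)
  obtain ⟨n, hn⟩ : ∃ n, T.card = n + 1 :=
    Nat.exists_eq_succ_of_ne_zero (Finset.card_ne_zero_of_mem (hnat 0 (Nat.zero_le _)))
  set g := T.orderEmbOfFin hn with hg
  have hrange : ∀ s ∈ T, ∃ l, g l = s := fun s hs => by
    have : s ∈ Set.range g := by rw [hg, Finset.range_orderEmbOfFin]; exact hs
    exact this
  have hmem : ∀ l, g l ∈ T := fun l => Finset.orderEmbOfFin_mem _ _ _
  set b : ℕ → ℝ := fun m => if h : m < n + 1 then g ⟨m, h⟩ else 0 with hb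
  have hbm : ∀ m (h : m < n + 1), b m = g ⟨m, h⟩ := fun m h => dif_pos h
  have hgap : ∀ s ∈ T, ∀ m < n, s ≤ b m ∨ b (m + 1) ≤ s := by
    intro s hs m hm
    obtain ⟨l, rfl⟩ := hrange s hs
    rw [hbm m (by omega), hbm (m + 1) (by omega), g.le_iff_le, g.le_iff_le]
    rcases Nat.lt_or_ge m l with h | h
    · right; exact h
    · left; exact h
  have htop : ∀ s ∈ T, s ≤ b n := by
    intro s hs
    obtain ⟨l, rfl⟩ := hrange s hs
    rw [hbm n (by omega), g.le_iff_le]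
    exact Nat.lt_succ_iff.1 l.2
  refine ⟨n, b, ?_, fun m hm => ?_, fun m hm => ?_, fun s hs => htop s (hST hs),
    fun s hs => hgap s (hST hs)⟩
  · refine le_antisymm ?_ ?_
    · obtain ⟨l, hl⟩ := hrange 0 (by simpa using hnat 0 (Nat.zero_le _))
      rw [hbm 0 (by omega), ← hl, g.le_iff_le]
      exact Nat.zero_le _
    · rw [hbm 0 (by omega)]
      exact hT0 _ (hmem _)
  · rw [hbm m (by omega), hbm (m + 1) (by omega), g.le_iff_le]
    exact Nat.le_succ m
  · have h0 : 0 ≤ b m := by rw [hbm m (by omega)]; exact hT0 _ (hmem _)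
    have hlt : b m < b (m + 1) := by
      rw [hbm m (by omega), hbm (m + 1) (by omega), g.lt_iff_lt]
      exact Nat.lt_succ_self m
    have hle : b (m + 1) ≤ N := by rw [hbm (m + 1) (by omega)]; exact hTN _ (hmem _)
    have hfl : ⌊b m⌋₊ < N := (Nat.floor_lt h0).2 (by linarith)
    have h1 := Nat.lt_floor_add_one (b m)
    have h2 := Nat.floor_le h0
    rcases hgap _ (hnat (⌊b m⌋₊ + 1) hfl) m hm with h | h
    · push_cast at h; linarith
    · push_cast at h; linarith

/-- View facility `i` as the interval `[0, yt i]`, of which client `j` occupies `[0, xt i j]`, and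
cut all facilities at common breakpoints that include every such endpoint. No piece is then cut by a
client's endpoint. Pieces beyond `yt i` become copies of value zero, which is harmless. -/
theorem exists_isCompleteSplitting {F C : Type*} [Fintype F] [Fintype C] (yt : F → ℝ)
    (xt : F → C → ℝ) (hx : ∀ i j, 0 ≤ xt i j) (hxy : ∀ i j, xt i j ≤ yt i) (hy : ∀ i, 0 ≤ yt i) :
    ∃ (n : ℕ) (orig : Fin n → F) (yb : Fin n → ℝ) (xb : Fin n → C → ℝ),
      IsCompleteSplitting yt xt orig yb xb := by
  classical
  obtain ⟨n, b, hb0, hmono, hlen, htop, hgap⟩ := exists_breakpoints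
    (Finset.univ.image yt ∪ Finset.univ.image (fun p : F × C => xt p.1 p.2)) (by
      intro s hs
      rcases Finset.mem_union.1 hs with h | h
      · obtain ⟨i, -, rfl⟩ := Finset.mem_image.1 h; exact hy i
      · obtain ⟨p, -, rfl⟩ := Finset.mem_image.1 h; exact hx _ _)
  have hyS : ∀ i, yt i ∈ Finset.univ.image yt ∪ Finset.univ.image (fun p : F × C => xt p.1 p.2) :=
    fun i => Finset.mem_union_left _ (Finset.mem_image_of_mem _ (Finset.mem_univ _))
  have hxS : ∀ i j,
      xt i j ∈ Finset.univ.image yt ∪ Finset.univ.image (fun p : F × C => xt p.1 p.2) :=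
    fun i j => Finset.mem_union_right _
      (Finset.mem_image_of_mem (fun p : F × C => xt p.1 p.2) (Finset.mem_univ (i, j)))
  let e := Fintype.equivFin (F × Fin n)
  let Y : F × Fin n → ℝ := fun p => min (yt p.1) (b (p.2 + 1)) - min (yt p.1) (b p.2)
  let Z : F × Fin n → C → ℝ := fun p j =>
    min (xt p.1 j) (b (p.2 + 1)) - min (xt p.1 j) (b p.2)
  have hfib : ∀ (i : F) (f : F × Fin n → ℝ),
      ∑ k with (e.symm k).1 = i, f (e.symm k) = ∑ m, f (i, m) := by
    intro i f
    rw [Finset.sum_filter, Equiv.sum_comp e.symm (fun p => if p.1 = i then f p else 0),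
      Fintype.sum_prod_type, Finset.sum_eq_single i]
    · simp
    · intro i' _ h; simp [h]
    · simp
  have htel : ∀ s : ℝ, 0 ≤ s → s ≤ b n →
      ∑ m : Fin n, (min s (b (m + 1)) - min s (b m)) = s := by
    intro s h0 hs
    rw [Fin.sum_univ_eq_sum_range (fun m => min s (b (m + 1)) - min s (b m)) n,
      Finset.sum_range_sub (fun m => min s (b m)), hb0, min_eq_left hs, min_eq_right h0, sub_zero]
  refine ⟨_, fun k => (e.symm k).1, fun k => Y (e.symm k), fun k j => Z (e.symm k) j, ?_⟩
  refine ⟨fun k => ?_, fun k => ?_, fun i => ?_, fun i j => ?_, fun k j => ?_⟩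
  · exact sub_nonneg.2 (min_le_min le_rfl (hmono _ (e.symm k).2.2))
  · obtain ⟨i, m⟩ := e.symm k
    have := hlen m m.2
    simp only [Y]
    rcases le_total (yt i) (b m) with h | h
    · rw [min_eq_left h]; linarith [min_le_left (yt i) (b (m + 1))]
    · rw [min_eq_right h]; linarith [min_le_right (yt i) (b (m + 1))]
  · have := hfib i Y
    convert this.trans (htel (yt i) (hy i) (htop _ (hyS i)))
  · have := hfib i (fun p => Z p j)
    convert this.trans (htel (xt i j) (hx i j) (htop _ (hxS i j)))
  · obtain ⟨i, m⟩ := e.symm k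
    simp only [Y, Z]
    rcases hgap _ (hxS i j) m m.2 with h | h
    · left
      rw [min_eq_left h, min_eq_left (h.trans (hmono m m.2)), sub_self]
    · right
      have h1 := h.trans (hxy i j)
      have h2 := hmono m m.2
      rw [min_eq_right h, min_eq_right (h2.trans h), min_eq_right h1, min_eq_right (h2.trans h1)]

theorem exists_csRun {F C X : Type*} [Fintype F] [Fintype C] [PseudoMetricSpace X]
    (I : MetricInstance F C X) {γ : ℝ} (hγ : 1 ≤ γ) {x : F → C → ℝ} {y : F → ℝ}
    (hxy : IsFeasible x y) : ∃ n : ℕ, Nonempty (CSRun I γ y (Fin n)) := by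
  have hy : ∀ i, 0 ≤ γ * y i := fun i => mul_nonneg (by linarith) (hxy.open_nonneg i)
  obtain ⟨xt, hxt⟩ := I.exists_isClosestAssignment (fun i => γ * y i) hy (by
    rintro ⟨j⟩
    rw [← hxy.sum_eq_one j]
    refine Finset.sum_le_sum fun i _ => (hxy.le_open i j).trans ?_
    nlinarith [hxy.open_nonneg i])
  obtain ⟨n, orig, yb, xb, hs⟩ :=
    exists_isCompleteSplitting _ xt hxt.nonneg hxt.le_open hy
  obtain ⟨L, hL⟩ := exists_isGreedyClustering
    (fun j => ∑ k, I.conn (orig k) j * xb k j +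
      sSup ((fun k => I.conn (orig k) j) '' {k | 0 < xb k j}))
    (fun j j' => ∃ k, 0 < xb k j ∧ 0 < xb k j') Set.univ
  exact ⟨n, ⟨⟨xt, hxt, orig, yb, xb, hs, L, hL⟩⟩⟩

/-! ### Properties of the greedy clustering. -/

theorem IsGreedyClustering.mem {C : Type*} {score : C → ℝ} {share : C → C → Prop} {R : Set C}
    {L : List C} (h : IsGreedyClustering score share R L) : ∀ j ∈ L, j ∈ R := by
  induction h with
  | done => simp
  | pick R j L hj hmin hrest ih =>
    intro j' hj'
    rcases List.mem_cons.1 hj' with rfl | h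
    · exact hj
    · exact (ih j' h).1

theorem IsGreedyClustering.pairwise {C : Type*} {score : C → ℝ} {share : C → C → Prop} {R : Set C}
    {L : List C} (h : IsGreedyClustering score share R L) :
    L.Pairwise fun j j' => ¬ share j j' := by
  induction h with
  | done => simp
  | pick R j L hj hmin hrest ih => exact List.pairwise_cons.2 ⟨fun j' h => (hrest.mem j' h).2.2, ih⟩

/-- A client is removed at the moment when a center sharing with it (possibly itself, hence `hrefl`)
is picked, and it was then still a candidate for the minimum. -/
theorem IsGreedyClustering.exists_center {C : Type*} {score : C → ℝ} {share : C → C → Prop}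
    {R : Set C} {L : List C} (h : IsGreedyClustering score share R L)
    (hrefl : ∀ j, share j j) : ∀ j ∈ R, ∃ j' ∈ L, share j' j ∧ score j' ≤ score j := by
  induction h with
  | done => simp
  | pick R c L hc hmin hrest ih =>
    intro j hj
    by_cases h : j ≠ c ∧ ¬ share c j
    · obtain ⟨j', h1, h2⟩ := ih j ⟨hj, h⟩
      exact ⟨j', List.mem_cons_of_mem _ h1, h2⟩
    · refine ⟨c, List.mem_cons_self, ?_, hmin j hj⟩
      by_contra hs
      exact h ⟨fun he => hs (he ▸ hrefl c), hs⟩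

/-! ### Independence, opening probabilities and opening costs. -/

namespace CSRun

variable {F C X K : Type*} [Fintype F] [Fintype C] [PseudoMetricSpace X] [Fintype K]
  {I : MetricInstance F C X} {γ : ℝ} {y : F → ℝ}

theorem xb_nonneg (R : CSRun I γ y K) (k : K) (j : C) : 0 ≤ R.xb k j := by
  rcases R.splitting.complete k j with h | h <;> rw [h]
  exact R.splitting.nonneg k

theorem xb_le_yb (R : CSRun I γ y K) (k : K) (j : C) : R.xb k j ≤ R.yb k := by
  rcases R.splitting.complete k j with h | h <;> rw [h]
  exact R.splitting.nonneg k

theorem xb_eq_yb (R : CSRun I γ y K) {k : K} {j : C} (h : 0 < R.xb k j) : R.xb k j = R.yb k :=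
  (R.splitting.complete k j).resolve_left h.ne'

theorem sum_xb_mul (R : CSRun I γ y K) (f : F → ℝ) (j : C) :
    ∑ k, R.xb k j * f (R.orig k) = ∑ i, R.xt i j * f i := by
  classical
  rw [← Finset.sum_fiberwise Finset.univ R.orig]
  refine Finset.sum_congr rfl fun i _ => ?_
  rw [← R.splitting.sum_assign i j, Finset.sum_mul]
  refine Finset.sum_congr (by ext; simp) fun k hk => ?_
  rw [(Finset.mem_filter.1 hk).2]

theorem sum_xb (R : CSRun I γ y K) (j : C) : ∑ k, R.xb k j = 1 := by
  have := R.sum_xb_mul (fun _ => 1) j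
  simpa [R.xt_closest.sum_eq_one j] using this

theorem exists_xb_pos (R : CSRun I γ y K) (j : C) : ∃ k, 0 < R.xb k j := by
  by_contra! h
  have := Finset.sum_nonpos fun k (_ : k ∈ Finset.univ) => h k
  rw [R.sum_xb j] at this
  linarith

theorem expect_mono (R : CSRun I γ y K) {Z Z' : R.Outcome → ℝ}
    (h : ∀ ω, R.prob ω ≠ 0 → Z ω ≤ Z' ω) : R.expect Z ≤ R.expect Z' := by
  refine Finset.sum_le_sum fun ω _ => ?_
  by_cases h0 : R.prob ω = 0
  · simp [h0]
  · exact mul_le_mul_of_nonneg_left (h ω h0) (R.prob_nonneg ω)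

theorem expect_congr (R : CSRun I γ y K) {Z Z' : R.Outcome → ℝ}
    (h : ∀ ω, R.prob ω ≠ 0 → Z ω = Z' ω) : R.expect Z = R.expect Z' :=
  le_antisymm (R.expect_mono fun ω h0 => (h ω h0).le) (R.expect_mono fun ω h0 => (h ω h0).ge)

theorem expect_sum (R : CSRun I γ y K) {ι : Type*} (s : Finset ι) (Z : ι → R.Outcome → ℝ) :
    R.expect (fun ω => ∑ i ∈ s, Z i ω) = ∑ i ∈ s, R.expect (Z i) := by
  simp only [expect, Finset.mul_sum]
  exact Finset.sum_comm

theorem expect_mul_left (R : CSRun I γ y K) (c : ℝ) (Z : R.Outcome → ℝ) :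
    R.expect (fun ω => c * Z ω) = c * R.expect Z := by
  simp only [expect, Finset.mul_sum]
  exact Finset.sum_congr rfl fun _ _ => by ring

open Classical in
theorem ite_inCluster (R : CSRun I γ y K) (t : Fin R.centers.length) (k : K) :
    (if R.InCluster t k then R.yb k else 0) = R.xb k (R.centers.get t) := by
  split_ifs with h
  · exact (R.xb_eq_yb h).symm
  · exact le_antisymm (R.xb_nonneg _ _) (not_lt.1 h)

/-- The random choices are independent. -/
theorem expect_prod (R : CSRun I γ y K) (a : Fin R.centers.length → K → ℝ) (b : K → Bool → ℝ) :
    R.expect (fun ω => (∏ t, a t (ω.1 t)) * ∏ k, b k (ω.2 k)) =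
      (∏ t, ∑ k, R.xb k (R.centers.get t) * a t k) *
        ∏ k, (R.yb k * b k true + (1 - R.yb k) * b k false) := by
  classical
  have h2 : ∀ k, R.yb k * b k true + (1 - R.yb k) * b k false =
      ∑ c : Bool, (if c = true then R.yb k else 1 - R.yb k) * b k c := fun k => by simp
  simp only [h2]
  rw [Fintype.prod_sum, Fintype.prod_sum, Finset.sum_mul_sum, ← Fintype.sum_prod_type']
  unfold expect
  have hu : (Finset.univ : Finset R.Outcome) = Finset.univ := rfl
  convert Finset.sum_congr hu fun ω _ => ?_
  simp only [prob, ite_inCluster, Finset.prod_mul_distrib]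
  ring

theorem expect_choice (R : CSRun I γ y K) (t : Fin R.centers.length) (f : K → ℝ) :
    R.expect (fun ω => f (ω.1 t)) = ∑ k, R.xb k (R.centers.get t) * f k := by
  classical
  have h := R.expect_prod (fun s k => if s = t then f k else 1) (fun _ _ => 1)
  simp only [Finset.prod_ite_eq', Finset.mem_univ, if_true, Finset.prod_const_one, mul_one,
    add_sub_cancel] at h
  rw [h, Finset.prod_eq_single t]
  · simp
  · intro s _ hs; simp [hs, R.sum_xb]
  · simp

theorem expect_coin (R : CSRun I γ y K) (k : K) (f : Bool → ℝ) :
    R.expect (fun ω => f (ω.2 k)) = R.yb k * f true + (1 - R.yb k) * f false := by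
  classical
  have h := R.expect_prod (fun _ _ => 1) (fun k' b => if k' = k then f b else 1)
  simp only [Finset.prod_ite_eq', Finset.mem_univ, if_true, Finset.prod_const_one, mul_one,
    one_mul, R.sum_xb] at h
  rw [h, Finset.prod_eq_single k]
  · simp
  · intro s _ hs; simp [hs]
  · simp

theorem inCluster_of_prob_ne_zero (R : CSRun I γ y K) {ω : R.Outcome} (h : R.prob ω ≠ 0)
    (t : Fin R.centers.length) : R.InCluster t (ω.1 t) := by
  classical
  by_contra hc
  refine h ?_
  unfold prob
  rw [Finset.prod_eq_zero (Finset.mem_univ t), zero_mul]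
  rw [if_neg hc]

theorem eq_of_inCluster (R : CSRun I γ y K) {t t' : Fin R.centers.length} {k : K}
    (h : R.InCluster t k) (h' : R.InCluster t' k) : t = t' := by
  have hp := List.pairwise_iff_get.1 R.clustering.pairwise
  rcases lt_trichotomy t t' with hlt | heq | hlt
  · exact absurd ⟨k, h, h'⟩ (hp t t' hlt)
  · exact heq
  · exact absurd ⟨k, h', h⟩ (hp t' t hlt)

-- A copy in some cluster lies in exactly one, so almost surely it is opened only as the choice of
-- that cluster; a copy in no cluster is almost surely opened only by its coin.
open Classical in
theorem expect_isOpened (R : CSRun I γ y K) (k : K) :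
    R.expect (fun ω => if R.IsOpened ω k then 1 else 0) = R.yb k := by
  by_cases hk : ∃ t, R.InCluster t k
  · obtain ⟨t, ht⟩ := hk
    have h1 := R.expect_choice t fun k' => if k' = k then 1 else 0
    simp only [mul_ite, mul_one, mul_zero, Finset.sum_ite_eq', Finset.mem_univ, if_true] at h1
    rw [← R.xb_eq_yb ht, ← h1]
    refine R.expect_congr fun ω hω => ?_
    have : R.IsOpened ω k ↔ ω.1 t = k := by
      constructor
      · rintro (⟨t', h⟩ | h)
        · have := R.inCluster_of_prob_ne_zero hω t'
          rw [h] at this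
          rw [R.eq_of_inCluster ht this, h]
        · exact absurd ht (h.1 t)
      · exact fun h => Or.inl ⟨t, h⟩
    simp only [this]
  · push Not at hk
    have h1 := R.expect_coin k fun b => if b = true then 1 else 0
    simp only [if_true, Bool.false_eq_true, if_false, mul_one, mul_zero, add_zero] at h1
    rw [← h1]
    refine R.expect_congr fun ω hω => ?_
    have : R.IsOpened ω k ↔ ω.2 k = true := by
      constructor
      · rintro (⟨t', h⟩ | h)
        · have := R.inCluster_of_prob_ne_zero hω t'
          rw [h] at this
          exact absurd this (hk t')
        · exact h.2
      · exact fun h => Or.inr ⟨hk, h⟩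
    simp only [this]

theorem expect_openCost (R : CSRun I γ y K) (i : F) :
    R.expect (fun ω => R.openCost ω i) = γ * I.fracOpen y i := by
  classical
  have h : ∀ ω, R.openCost ω i =
      ∑ k with R.orig k = i, I.openCost i * if R.IsOpened ω k then 1 else 0 := by
    intro ω
    unfold openCost
    rw [← Finset.filter_filter, Finset.sum_filter]
    simp only [mul_ite, mul_one, mul_zero]
  simp only [h]
  rw [expect_sum]
  simp only [expect_mul_left, expect_isOpened]
  rw [← Finset.mul_sum, MetricInstance.fracOpen]
  have := R.splitting.sum_open i
  rw [mul_left_comm, ← this]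

theorem solOpen_le (R : CSRun I γ y K) (ω : R.Outcome) :
    I.solOpen (R.solution ω) ≤ ∑ i, R.openCost ω i := by
  classical
  have h0 : ∀ i, 0 ≤ R.openCost ω i := fun i =>
    Finset.sum_nonneg fun _ _ => I.openCost_nonneg i
  unfold MetricInstance.solOpen
  refine (Finset.sum_le_sum fun i hi => ?_).trans
    (Finset.sum_le_sum_of_subset_of_nonneg (Finset.subset_univ (R.solution ω)) fun i _ _ => h0 i)
  obtain ⟨k, hk⟩ := (Finset.mem_filter.1 hi).2
  refine Finset.single_le_sum (f := fun _ => I.openCost i)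
    (fun _ _ => I.openCost_nonneg i) (a := k) ?_
  simpa using hk

theorem connCost_nonneg (R : CSRun I γ y K) (ω : R.Outcome) (j : C) : 0 ≤ R.connCost ω j := by
  refine Real.sInf_nonneg ?_
  rintro _ ⟨i, -, rfl⟩
  exact dist_nonneg

theorem connCost_le (R : CSRun I γ y K) {ω : R.Outcome} (j : C) {k : K} (h : R.IsOpened ω k) :
    R.connCost ω j ≤ I.conn (R.orig k) j := by
  classical
  refine csInf_le ⟨0, ?_⟩ ⟨R.orig k, ?_, rfl⟩
  · rintro _ ⟨i, -, rfl⟩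
    exact dist_nonneg
  · simp only [solution, Finset.coe_filter, Finset.mem_univ, true_and, Set.mem_ofPred_eq]
    exact ⟨k, rfl, h⟩

end CSRun

/-! ### Comparing expectations by integrating tails. -/

/-- The indicator of the event that `d` exceeds `r`. -/
def step (d r : ℝ) : ℝ := if r < d then 1 else 0

theorem step_nonneg (d r : ℝ) : 0 ≤ step d r := by unfold step; split_ifs <;> norm_num

theorem step_le_one (d r : ℝ) : step d r ≤ 1 := by unfold step; split_ifs <;> norm_num

theorem step_of_lt {d r : ℝ} (h : r < d) : step d r = 1 := if_pos h

theorem step_of_le {d r : ℝ} (h : d ≤ r) : step d r = 0 := if_neg h.not_gt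

theorem intervalIntegrable_step (d a b : ℝ) :
    IntervalIntegrable (step d) MeasureTheory.volume a b := by
  refine Antitone.intervalIntegrable fun r r' h => ?_
  rcases lt_or_ge r d with h1 | h1
  · rw [step_of_lt h1]; exact step_le_one _ _
  · rw [step_of_le h1, step_of_le (h1.trans h)]

theorem integral_step {d T : ℝ} (h0 : 0 ≤ d) (hT : d ≤ T) : ∫ r in (0 : ℝ)..T, step d r = d := by
  have h1 : ∫ r in (0 : ℝ)..d, step d r = ∫ r in (0 : ℝ)..d, (1 : ℝ) := by
    rw [intervalIntegral.integral_of_le h0, intervalIntegral.integral_of_le h0,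
      MeasureTheory.integral_Ioc_eq_integral_Ioo, MeasureTheory.integral_Ioc_eq_integral_Ioo]
    exact MeasureTheory.setIntegral_congr_fun measurableSet_Ioo fun r hr => step_of_lt hr.2
  have h2 : ∫ r in d..T, step d r = 0 := by
    rw [intervalIntegral.integral_of_le hT]
    rw [MeasureTheory.setIntegral_congr_fun (g := fun _ => (0 : ℝ)) measurableSet_Ioc
      fun r hr => step_of_le hr.1.le]
    simp
  rw [← intervalIntegral.integral_add_adjacent_intervals (intervalIntegrable_step _ _ _)
    (intervalIntegrable_step _ _ _), h1, h2]
  simp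

/-- Comparing tails compares weighted sums. -/
theorem sum_mul_le_sum_mul_of_step {ι κ : Type*} [Fintype ι] [Fintype κ] (p Z : ι → ℝ)
    (c d : κ → ℝ) (hZ : ∀ i, 0 ≤ Z i) (hd : ∀ k, 0 ≤ d k)
    (h : ∀ r, 0 ≤ r → ∑ i, p i * step (Z i) r ≤ ∑ k, c k * step (d k) r) :
    ∑ i, p i * Z i ≤ ∑ k, c k * d k := by
  set T := ∑ i, Z i + ∑ k, d k
  have h1 : ∀ i, Z i ≤ T := fun i =>
    (Finset.single_le_sum (fun i _ => hZ i) (Finset.mem_univ i)).trans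
      (le_add_of_nonneg_right (Finset.sum_nonneg fun k _ => hd k))
  have h2 : ∀ k, d k ≤ T := fun k =>
    (Finset.single_le_sum (fun i _ => hd i) (Finset.mem_univ k)).trans
      (le_add_of_nonneg_left (Finset.sum_nonneg fun k _ => hZ k))
  have hT : 0 ≤ T := add_nonneg (Finset.sum_nonneg fun i _ => hZ i)
    (Finset.sum_nonneg fun i _ => hd i)
  have h3 : ∀ i, IntervalIntegrable (fun r => p i * step (Z i) r) MeasureTheory.volume 0 T :=
    fun i => (intervalIntegrable_step _ _ _).const_mul _
  have h4 : ∀ k, IntervalIntegrable (fun r => c k * step (d k) r) MeasureTheory.volume 0 T :=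
    fun k => (intervalIntegrable_step _ _ _).const_mul _
  have h5 : ∑ i, p i * Z i = ∫ r in (0 : ℝ)..T, ∑ i, p i * step (Z i) r := by
    rw [intervalIntegral.integral_finsetSum fun i _ => h3 i]
    exact Finset.sum_congr rfl fun i _ => by
      rw [intervalIntegral.integral_const_mul, integral_step (hZ i) (h1 i)]
  have h6 : ∑ k, c k * d k = ∫ r in (0 : ℝ)..T, ∑ k, c k * step (d k) r := by
    rw [intervalIntegral.integral_finsetSum fun i _ => h4 i]
    exact Finset.sum_congr rfl fun i _ => by
      rw [intervalIntegral.integral_const_mul, integral_step (hd i) (h2 i)]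
  rw [h5, h6]
  refine intervalIntegral.integral_mono_on hT ?_ ?_ fun r hr => h r hr.1
  · simpa only [Finset.sum_fn] using IntervalIntegrable.sum Finset.univ fun i _ => h3 i
  · simpa only [Finset.sum_fn] using IntervalIntegrable.sum Finset.univ fun i _ => h4 i

/-! ### Exponential bound on the tail of the connection cost. -/

namespace CSRun

variable {F C X K : Type*} [Fintype F] [Fintype C] [PseudoMetricSpace X] [Fintype K]
  {I : MetricInstance F C X} {γ : ℝ} {y : F → ℝ}

/-- If the connection cost of `j` exceeds `r`, then no copy within distance `r` is open. -/
theorem expect_step_le (R : CSRun I γ y K) (j : C) (t : Fin R.centers.length) (r : ℝ) :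
    R.expect (fun ω => step (R.connCost ω j) r) ≤
      (∑ k, R.xb k (R.centers.get t) * step (I.conn (R.orig k) j) r) *
        Real.exp (-∑ k, (R.yb k - R.xb k (R.centers.get t)) *
          (1 - step (I.conn (R.orig k) j) r)) := by
  classical
  set d : K → ℝ := fun k => I.conn (R.orig k) j with hd
  -- The factor vanishes exactly when an unclustered copy within distance `r` is opened by its coin,
  -- so the product below dominates the indicator.
  set b : K → Bool → ℝ := fun k c =>
    if (∀ t, ¬ R.InCluster t k) ∧ d k ≤ r ∧ c = true then 0 else 1 with hb
  have hb0 : ∀ k c, 0 ≤ b k c := fun k c => by simp only [hb]; split_ifs <;> norm_num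
  have h1 : R.expect (fun ω => step (R.connCost ω j) r) ≤
      R.expect (fun ω => (∏ s, step (d (ω.1 s)) r) * ∏ k, b k (ω.2 k)) := by
    refine R.expect_mono fun ω _ => ?_
    rcases lt_or_ge r (R.connCost ω j) with h | h
    · rw [step_of_lt h, Finset.prod_eq_one, Finset.prod_eq_one, one_mul]
      · intro k _
        refine if_neg fun hk => ?_
        have := R.connCost_le j (Or.inr ⟨hk.1, hk.2.2⟩ : R.IsOpened ω k)
        exact absurd (h.trans_le this) hk.2.1.not_gt
      · intro s _
        exact step_of_lt (h.trans_le (R.connCost_le j (Or.inl ⟨s, rfl⟩)))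
    · rw [step_of_le h]
      exact mul_nonneg (Finset.prod_nonneg fun _ _ => step_nonneg _ _)
        (Finset.prod_nonneg fun _ _ => hb0 _ _)
  refine h1.trans ?_
  rw [R.expect_prod (fun _ k => step (d k) r) b]
  -- A cluster has total value one, so its value beyond `r` is one minus its value within `r`.
  have hM : ∀ s : Fin R.centers.length, ∑ k, R.xb k (R.centers.get s) * step (d k) r ≤
      Real.exp (-∑ k, R.xb k (R.centers.get s) * (1 - step (d k) r)) := by
    intro s
    have := Real.add_one_le_exp (-∑ k, R.xb k (R.centers.get s) * (1 - step (d k) r))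
    simp only [mul_sub, mul_one, Finset.sum_sub_distrib, R.sum_xb] at this ⊢
    linarith
  have hM0 : ∀ s : Fin R.centers.length, 0 ≤ ∑ k, R.xb k (R.centers.get s) * step (d k) r :=
    fun s => Finset.sum_nonneg fun k _ => mul_nonneg (R.xb_nonneg _ _) (step_nonneg _ _)
  set c : K → ℝ := fun k => if ∀ t, ¬ R.InCluster t k then R.yb k * (1 - step (d k) r) else 0
    with hc
  have hcoin : ∀ k, R.yb k * b k true + (1 - R.yb k) * b k false ≤ Real.exp (-c k) := by
    intro k
    refine le_trans (le_of_eq ?_) (Real.add_one_le_exp (-c k))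
    by_cases h : ∀ t, ¬ R.InCluster t k
    · rcases lt_or_ge r (d k) with h' | h'
      · simp [hb, hc, h, h'.not_ge, step_of_lt h']
      · simp [hb, hc, h, h', step_of_le h']; ring
    · simp [hb, hc, h]
  have hcoin0 : ∀ k, 0 ≤ R.yb k * b k true + (1 - R.yb k) * b k false := fun k =>
    add_nonneg (mul_nonneg (R.splitting.nonneg k) (hb0 _ _))
      (mul_nonneg (sub_nonneg.2 (R.splitting.le_one k)) (hb0 _ _))
  -- The factor of cluster `t` is kept exact; all other factors are replaced by exponentials.
  rw [← Finset.mul_prod_erase Finset.univ _ (Finset.mem_univ t), mul_assoc]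
  refine mul_le_mul_of_nonneg_left ?_ (hM0 t)
  refine (mul_le_mul (Finset.prod_le_prod (fun s _ => hM0 s) fun s _ => hM s)
    (Finset.prod_le_prod (fun k _ => hcoin0 k) fun k _ => hcoin k)
    (Finset.prod_nonneg fun k _ => hcoin0 k)
    (Finset.prod_nonneg fun s _ => (Real.exp_pos _).le)).trans ?_
  rw [← Real.exp_sum, ← Real.exp_sum, ← Real.exp_add, Real.exp_le_exp, Finset.sum_neg_distrib,
    Finset.sum_neg_distrib, ← neg_add, neg_le_neg_iff, Finset.sum_comm, ← Finset.sum_add_distrib]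
  refine Finset.sum_le_sum fun k _ => ?_
  have hs : 0 ≤ 1 - step (d k) r := sub_nonneg.2 (step_le_one _ _)
  have hnn : ∀ s ∈ Finset.univ.erase t, 0 ≤ R.xb k (R.centers.get s) * (1 - step (d k) r) :=
    fun s _ => mul_nonneg (R.xb_nonneg _ _) hs
  -- Each copy is charged once: an unclustered one to its coin, one in a cluster `s ≠ t` to the
  -- factor of `s`. In cluster `t` there is nothing to charge, as `yb k - xb k` vanishes there.
  by_cases h : ∀ t, ¬ R.InCluster t k
  · have : c k = R.yb k * (1 - step (d k) r) := if_pos h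
    rw [this]
    refine le_add_of_nonneg_of_le (Finset.sum_nonneg hnn) (mul_le_mul_of_nonneg_right ?_ hs)
    linarith [R.xb_nonneg k (R.centers.get t)]
  · have : c k = 0 := if_neg h
    rw [this, add_zero]
    push Not at h
    obtain ⟨s, hs'⟩ := h
    by_cases hst : s = t
    · subst hst
      rw [R.xb_eq_yb hs', sub_self, zero_mul]
      exact Finset.sum_nonneg hnn
    · refine le_trans ?_ (Finset.single_le_sum hnn (Finset.mem_erase.2 ⟨hst, Finset.mem_univ s⟩))
      rw [R.xb_eq_yb hs']
      refine mul_le_mul_of_nonneg_right ?_ hs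
      linarith [R.xb_nonneg k (R.centers.get t)]

end CSRun

/-! ### The nearest copies of total value `γ`. -/

/-- `w` consists of an amount `γ` of copies closest with respect to the distances `d`, up to
distance `ρ`. It extends `u`. -/
structure IsNearestMass {K : Type*} [Fintype K] (yb d u w : K → ℝ) (γ ρ : ℝ) : Prop where
  ge : ∀ k, u k ≤ w k
  le_open : ∀ k, w k ≤ yb k
  sum_eq : ∑ k, w k = γ
  full : ∀ k, d k < ρ → w k = yb k
  empty : ∀ k, ρ < d k → w k = 0

/-- Let `ρ` be the smallest distance whose closed ball has value at least `γ`. Interpolate between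
`A`, which adds the open ball to `u`, and `B`, the closed ball: their totals enclose `γ`, and both
have the required form away from distance `ρ`. -/
theorem exists_isNearestMass {K : Type*} [Fintype K] {yb d u : K → ℝ} {γ : ℝ} (hγ : 0 < γ)
    (hd : ∀ k, 0 ≤ d k) (hy : ∀ k, 0 ≤ yb k) (hu0 : ∀ k, 0 ≤ u k) (huy : ∀ k, u k ≤ yb k)
    (hu : ∑ k, u k ≤ γ) (hγy : γ ≤ ∑ k, yb k)
    (hnear : ∀ k k', d k < d k' → u k < yb k → u k' = 0) :
    ∃ w ρ, 0 ≤ ρ ∧ IsNearestMass yb d u w γ ρ := by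
  classical
  have hne : (Finset.univ : Finset K).Nonempty := by
    rw [Finset.nonempty_iff_ne_empty]
    intro h
    rw [h, Finset.sum_empty] at hγy
    linarith
  obtain ⟨kmax, -, hkmax⟩ := Finset.exists_max_image Finset.univ d hne
  obtain ⟨k₁, hk₁, hmin⟩ := Finset.exists_min_image
    (Finset.univ.filter fun k => γ ≤ ∑ k', if d k' ≤ d k then yb k' else 0) d
    ⟨kmax, by simpa [hkmax] using hγy⟩
  have hγB : γ ≤ ∑ k', if d k' ≤ d k₁ then yb k' else 0 := (Finset.mem_filter.1 hk₁).2
  have hlow : (∑ k, if d k < d k₁ then yb k else 0) ≤ γ := by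
    rcases (Finset.univ.filter fun k => d k < d k₁).eq_empty_or_nonempty with h | h
    · rw [← Finset.sum_filter, h, Finset.sum_empty]
      exact hγ.le
    · obtain ⟨k₂, hk₂, hmax⟩ := Finset.exists_max_image _ d h
      have hk₂' : d k₂ < d k₁ := (Finset.mem_filter.1 hk₂).2
      by_contra hc
      push Not at hc
      refine (hmin k₂ (Finset.mem_filter.2 ⟨Finset.mem_univ _, hc.le.trans ?_⟩)).not_gt hk₂'
      refine Finset.sum_le_sum fun k _ => ?_
      by_cases h1 : d k < d k₁
      · rw [if_pos h1, if_pos (hmax k (by simpa using h1))]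
      · rw [if_neg h1]
        split_ifs
        exacts [hy k, le_rfl]
  set A : K → ℝ := fun k => if d k < d k₁ then yb k else u k with hA
  set B : K → ℝ := fun k => if d k ≤ d k₁ then yb k else 0 with hB
  have hAγ : ∑ k, A k ≤ γ := by
    -- If `u` reaches distance `d k₁`, it already uses everything closer and `A` adds nothing to it;
    -- otherwise `A` is at most the open ball, whose value is at most `γ`.
    by_cases h : ∃ k, d k₁ ≤ d k ∧ u k ≠ 0
    · obtain ⟨k, hk, hk0⟩ := h
      refine (Finset.sum_le_sum fun k' _ => ?_).trans hu
      simp only [hA]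
      split_ifs with h1
      · by_contra hc
        exact hk0 (hnear k' k (h1.trans_le hk) (not_le.1 hc))
      · exact le_rfl
    · push Not at h
      refine (Finset.sum_le_sum fun k' _ => ?_).trans hlow
      simp only [hA]
      split_ifs with h1
      · exact le_rfl
      · exact (h k' (not_lt.1 h1)).le
  have hfar : ∀ k, d k₁ < d k → u k = 0 := by
    intro k hk
    by_contra h0
    -- If `u` reached beyond the closed ball, it would exhaust the ball and have total value more
    -- than `γ`.
    have h1 : ∀ k', B k' ≤ u k' := by
      intro k'
      simp only [hB]
      split_ifs with h2
      · by_contra hc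
        exact h0 (hnear k' k (h2.trans_lt hk) (not_le.1 hc))
      · exact hu0 k'
    have h2 : ∑ k', B k' < ∑ k', u k' := Finset.sum_lt_sum (fun k' _ => h1 k')
      ⟨k, Finset.mem_univ _, by
        simp only [hB, if_neg hk.not_ge]
        exact lt_of_le_of_ne (hu0 k) (Ne.symm h0)⟩
    linarith
  have hAB : ∀ k, A k ≤ B k := by
    intro k
    simp only [hA, hB]
    rcases lt_trichotomy (d k) (d k₁) with h | h | h
    · rw [if_pos h, if_pos h.le]
    · rw [if_neg h.not_lt, if_pos h.le]; exact huy k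
    · rw [if_neg h.not_gt, if_neg h.not_ge]; exact (hfar k h).le
  have huA : ∀ k, u k ≤ A k := by
    intro k
    simp only [hA]
    split_ifs
    exacts [huy k, le_rfl]
  have hBy : ∀ k, B k ≤ yb k := by
    intro k
    simp only [hB]
    split_ifs
    exacts [le_rfl, hy k]
  obtain ⟨θ, h0, h1, hθ⟩ : ∃ θ : ℝ, 0 ≤ θ ∧ θ ≤ 1 ∧
      ∑ k, A k + θ * (∑ k, B k - ∑ k, A k) = γ := by
    rcases eq_or_lt_of_le (hAγ.trans hγB) with h | h
    · exact ⟨0, le_rfl, zero_le_one, by linarith⟩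
    · refine ⟨(γ - ∑ k, A k) / (∑ k, B k - ∑ k, A k), div_nonneg (by linarith) (by linarith), ?_, ?_⟩
      · rw [div_le_one (by linarith)]; linarith
      · rw [div_mul_cancel₀ _ (by linarith)]; ring
  refine ⟨fun k => A k + θ * (B k - A k), d k₁, hd _, ?_, ?_, ?_, ?_, ?_⟩
  · intro k
    have := mul_nonneg h0 (sub_nonneg.2 (hAB k))
    linarith [huA k]
  · intro k
    have := mul_le_mul_of_nonneg_right h1 (sub_nonneg.2 (hAB k))
    linarith [hBy k]
  · rw [Finset.sum_add_distrib, ← Finset.mul_sum, Finset.sum_sub_distrib, hθ]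
  · intro k hk
    simp [hA, hB, hk, hk.le]
  · intro k hk
    simp [hA, hB, hk.not_ge, hk.not_gt, hfar k hk]

/-- The tail bounds are exponential in the mass beyond `r`; chords make them linear in it, so that
integrating over `r` yields average distances. -/
theorem exp_chord {x y t : ℝ} (h0 : 0 ≤ t) (h1 : t ≤ 1) :
    Real.exp (x + t * (y - x)) ≤ Real.exp x + t * (Real.exp y - Real.exp x) := by
  have := convexOn_exp.2 (Set.mem_univ x) (Set.mem_univ y) (sub_nonneg.2 h1) h0 (by ring)
  simp only [smul_eq_mul] at this
  calc _ = Real.exp ((1 - t) * x + t * y) := by ring_nf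
    _ ≤ _ := this
    _ = _ := by ring

/-! ### Distance to the part of the neighboring cluster outside the nearest mass. -/

/-- The part of the cluster of a neighbor `j'` of `j` that lies outside of the nearest mass `w` of
`j` is on average not too far from `j`. Here `d` and `d'` are the distances of the copies to `j` and
`j'`, `u` and `v` are the assignments of these two clients, and `D` is the average distance of the
distant copies `w - u` of `j`. -/
theorem sum_residual_mul_le {K : Type*} [Fintype K] {yb u v w d d' : K → ℝ} {γ δ m m' D : ℝ}
    (hγ : γ ≤ 2) (hy : ∀ k, 0 ≤ yb k) (hu : ∀ k, u k = 0 ∨ u k = yb k)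
    (hv : ∀ k, v k = 0 ∨ v k = yb k) (huw : ∀ k, u k ≤ w k) (hwy : ∀ k, w k ≤ yb k)
    (hu1 : ∑ k, u k = 1) (hv1 : ∑ k, v k = 1) (hw : ∑ k, w k = γ)
    (hd : ∀ k, d k ≤ δ + d' k) (hδ : ∀ k, δ ≤ d k + d' k)
    (hm : ∀ k, 0 < u k → d k ≤ m) (hm_far : ∀ k, u k < w k → m ≤ d k)
    (hm' : ∀ k, 0 < v k → d' k ≤ m') (hD : (γ - 1) * D = ∑ k, (w k - u k) * d k) (hmD : m ≤ D)
    (hshare : ∃ k, 0 < u k ∧ 0 < v k) :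
    ∑ k, (v k - min (v k) (w k)) * d k ≤
      (∑ k, (v k - min (v k) (w k))) * (D + m' + ∑ k, v k * d' k) := by
  have hu0 : ∀ k, 0 ≤ u k := fun k => by rcases hu k with h | h <;> rw [h]; exact hy k
  have hZ0 : ∀ k, 0 ≤ v k - min (v k) (w k) := fun k => sub_nonneg.2 (min_le_left _ _)
  have hZv : ∀ k, v k - min (v k) (w k) = 0 ∨ 0 < v k := by
    intro k
    rcases hv k with h | h
    · left
      rw [h, min_eq_left ((hu0 k).trans (huw k)), sub_zero]
    · rcases (hy k).eq_or_lt with h' | h'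
      · left
        rw [h, ← h', min_eq_left ((hu0 k).trans (huw k)), sub_zero]
      · right; rwa [h]
  have hδm : δ ≤ m + m' := by
    obtain ⟨k, h1, h2⟩ := hshare
    linarith [hδ k, hm k h1, hm' k h2]
  -- If the clients are this close, the triangle inequality bounds every residual copy separately.
  -- Otherwise copies of `v` inside `w` are far from `j'`; they use up the average `∑ v d'` and
  -- force the residual ones to be close to `j'`.
  rcases le_or_gt δ (D + ∑ k, v k * d' k) with hcase | hcase
  · rw [Finset.sum_mul]
    refine Finset.sum_le_sum fun k _ => ?_
    rcases hZv k with h | h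
    · simp [h]
    · refine mul_le_mul_of_nonneg_left ?_ (hZ0 k)
      linarith [hd k, hm' k h]
  have hQ0 : ∀ k, 0 ≤ min (v k) (w k) - min (v k) (u k) :=
    fun k => sub_nonneg.2 (min_le_min le_rfl (huw k))
  have hQw : ∀ k, min (v k) (w k) - min (v k) (u k) ≤ w k - u k := by
    intro k
    rcases hv k with h | h
    · rw [h, min_eq_left (hu0 k), min_eq_left ((hu0 k).trans (huw k))]
      linarith [huw k]
    · rw [h, min_eq_right (hwy k), min_eq_right ((huw k).trans (hwy k))]
  have hv0 : ∀ k, 0 ≤ v k := fun k => by rcases hv k with h | h <;> rw [h]; exact hy k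
  have hP : (∑ k, min (v k) (u k)) * (δ - m) ≤ ∑ k, min (v k) (u k) * d' k := by
    rw [Finset.sum_mul]
    refine Finset.sum_le_sum fun k _ => ?_
    rcases (hu0 k).eq_or_lt with h | h
    · rw [← h, min_eq_right (hv0 k)]; simp
    · refine mul_le_mul_of_nonneg_left ?_ (le_min (hv0 k) (hu0 k))
      linarith [hδ k, hm k h]
  have hQ : (∑ k, (min (v k) (w k) - min (v k) (u k))) * δ -
      ∑ k, (min (v k) (w k) - min (v k) (u k)) * d k ≤
      ∑ k, (min (v k) (w k) - min (v k) (u k)) * d' k := by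
    rw [Finset.sum_mul, ← Finset.sum_sub_distrib]
    refine Finset.sum_le_sum fun k _ => ?_
    nlinarith [hQ0 k, hδ k]
  -- The distant copies of `j` not used by `v` are still at distance at least `m`, which bounds the
  -- total distance of those used by `v`.
  have hW : ((γ - 1) - ∑ k, (min (v k) (w k) - min (v k) (u k))) * m ≤
      (γ - 1) * D - ∑ k, (min (v k) (w k) - min (v k) (u k)) * d k := by
    rw [hD, ← hw, ← hu1, ← Finset.sum_sub_distrib, ← Finset.sum_sub_distrib,
      ← Finset.sum_sub_distrib, Finset.sum_mul]
    refine Finset.sum_le_sum fun k _ => ?_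
    rw [← sub_mul]
    rcases (huw k).eq_or_lt with h | h
    · rw [h]; simp
    · exact mul_le_mul_of_nonneg_left (hm_far k h) (sub_nonneg.2 (hQw k))
  have hZ : ∑ k, (v k - min (v k) (w k)) * d k ≤ (∑ k, (v k - min (v k) (w k))) * δ +
      ∑ k, (v k - min (v k) (w k)) * d' k := by
    rw [Finset.sum_mul, ← Finset.sum_add_distrib]
    refine Finset.sum_le_sum fun k _ => ?_
    nlinarith [hZ0 k, hd k]
  have hmass : ∑ k, min (v k) (u k) + ∑ k, (min (v k) (w k) - min (v k) (u k)) +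
      ∑ k, (v k - min (v k) (w k)) = 1 := by
    rw [← hv1, ← Finset.sum_add_distrib, ← Finset.sum_add_distrib]
    exact Finset.sum_congr rfl fun k _ => by ring
  have hcost : ∑ k, min (v k) (u k) * d' k +
      ∑ k, (min (v k) (w k) - min (v k) (u k)) * d' k +
      ∑ k, (v k - min (v k) (w k)) * d' k = ∑ k, v k * d' k := by
    rw [← Finset.sum_add_distrib, ← Finset.sum_add_distrib]
    exact Finset.sum_congr rfl fun k _ => by ring
  have hp0 : 0 ≤ ∑ k, min (v k) (u k) := Finset.sum_nonneg fun k _ => le_min (hv0 k) (hu0 k)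
  have hq0 : 0 ≤ ∑ k, (min (v k) (w k) - min (v k) (u k)) := Finset.sum_nonneg fun k _ => hQ0 k
  have hz0 : 0 ≤ ∑ k, (v k - min (v k) (w k)) := Finset.sum_nonneg fun k _ => hZ0 k
  generalize ∑ k, min (v k) (u k) = p at *
  generalize ∑ k, (min (v k) (w k) - min (v k) (u k)) = q at *
  generalize ∑ k, (v k - min (v k) (w k)) = z at *
  generalize ∑ k, v k * d' k = a at *
  -- The claim is now a linear combination of the estimates above and these four products; after
  -- using `p + q + z = 1`, the slack that remains is `(2 - γ) (D - m)`.
  have e1 := mul_nonneg hz0 (sub_nonneg.2 hδm)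
  have e2 := mul_nonneg hp0 (sub_nonneg.2 hcase.le)
  have e3 := mul_nonneg hq0 (sub_nonneg.2 hcase.le)
  have e4 := mul_nonneg (sub_nonneg.2 hγ) (sub_nonneg.2 hmD)
  obtain rfl : p = 1 - q - z := by linarith
  nlinarith

/-! ### Linear bounds for the tails. -/

section Tail

variable {K : Type*} [Fintype K] {yb d u v w : K → ℝ} {γ ρ r q : ℝ}

/-- The tail of the connection cost, if the fallback is needed. -/
theorem tail_le_of_residual (hy : ∀ k, 0 ≤ yb k) (hγ : 1 < γ)
    (hu : ∀ k, 0 ≤ u k) (hu1 : ∑ k, u k = 1) (hnear : ∀ k k', d k < d k' → u k < yb k → u k' = 0)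
    (hv : ∀ k, v k = 0 ∨ v k = yb k) (hv1 : ∑ k, v k = 1) (hw : IsNearestMass yb d u w γ ρ)
    (hq : q ≤ (∑ k, v k * step (d k) r) *
      Real.exp (-∑ k, (yb k - v k) * (1 - step (d k) r))) :
    q ≤ (1 - Real.exp (-1)) * ∑ k, u k * step (d k) r +
      (Real.exp (-1) - Real.exp (-γ)) / (γ - 1) * ∑ k, (w k - u k) * step (d k) r +
      Real.exp (-γ) * step ρ r + Real.exp (-(γ - ∑ k, min (v k) (w k))) *
        (∑ k, (v k - min (v k) (w k)) * step (d k) r -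
          (1 - ∑ k, min (v k) (w k)) * step ρ r) := by
  have hv0 : ∀ k, 0 ≤ v k := fun k => by rcases hv k with h | h <;> rw [h]; exact hy k
  have hw0 : ∀ k, 0 ≤ w k := fun k => (hu k).trans (hw.ge k)
  have ha0 : 0 ≤ ∑ k, u k * step (d k) r :=
    Finset.sum_nonneg fun k _ => mul_nonneg (hu k) (step_nonneg _ _)
  have hb0 : 0 ≤ ∑ k, (w k - u k) * step (d k) r :=
    Finset.sum_nonneg fun k _ => mul_nonneg (sub_nonneg.2 (hw.ge k)) (step_nonneg _ _)
  have hγ1 : 0 < γ - 1 := by linarith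
  rcases lt_or_ge r ρ with hr | hr
  · rw [step_of_lt hr, mul_one, mul_one]
    -- All copies closer than `ρ` lie in `w`, so the residual part is entirely beyond `r` and its
    -- correction term vanishes.
    have hZ : ∑ k, (v k - min (v k) (w k)) * step (d k) r = 1 - ∑ k, min (v k) (w k) := by
      rw [← hv1, ← Finset.sum_sub_distrib]
      refine Finset.sum_congr rfl fun k _ => ?_
      rcases lt_or_ge r (d k) with h | h
      · rw [step_of_lt h, mul_one]
      · rw [hw.full k (h.trans_lt hr), min_eq_left, sub_self, zero_mul]
        rcases hv k with h | h <;> rw [h]; exact hy k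
    rw [hZ, sub_self, mul_zero, add_zero]
    have hexp : q ≤ Real.exp (-γ + ∑ k, u k * step (d k) r + ∑ k, (w k - u k) * step (d k) r) := by
      refine hq.trans ?_
      have h1 : ∑ k, v k * step (d k) r ≤ Real.exp (-∑ k, v k * (1 - step (d k) r)) := by
        have := Real.add_one_le_exp (-∑ k, v k * (1 - step (d k) r))
        simp only [mul_sub, mul_one, Finset.sum_sub_distrib, hv1] at this ⊢
        linarith
      refine (mul_le_mul_of_nonneg_right h1 (Real.exp_pos _).le).trans ?_
      rw [← Real.exp_add, Real.exp_le_exp, ← hw.sum_eq, ← Finset.sum_neg_distrib,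
        ← Finset.sum_neg_distrib, ← Finset.sum_neg_distrib, ← Finset.sum_add_distrib,
        ← Finset.sum_add_distrib, ← Finset.sum_add_distrib]
      refine Finset.sum_le_sum fun k _ => ?_
      rcases lt_or_ge r (d k) with h | h
      · rw [step_of_lt h]; linarith
      · rw [step_of_le h, hw.full k (h.trans_lt hr)]; linarith
    refine hexp.trans ?_
    -- If `u` reaches beyond `r`, everything nearer is used by `u`, so all of `w - u` is beyond `r`
    -- and the chord over `[-1, 0]` applies. Otherwise only `w - u` contributes, with the chord over
    -- `[-γ, -1]`.
    by_cases h0 : ∃ k, r < d k ∧ u k ≠ 0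
    · obtain ⟨k₀, hk₀, hk₀u⟩ := h0
      have hb : ∑ k, (w k - u k) * step (d k) r = γ - 1 := by
        rw [← hw.sum_eq, ← hu1, ← Finset.sum_sub_distrib]
        refine Finset.sum_congr rfl fun k _ => ?_
        rcases lt_or_ge r (d k) with h | h
        · rw [step_of_lt h, mul_one]
        · have : u k = w k := by
            refine le_antisymm (hw.ge k) ((hw.le_open k).trans ?_)
            by_contra hc
            exact hk₀u (hnear k k₀ (h.trans_lt hk₀) (not_le.1 hc))
          rw [this]; simp
      have ha1 : ∑ k, u k * step (d k) r ≤ 1 := by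
        rw [← hu1]
        exact Finset.sum_le_sum fun k _ => mul_le_of_le_one_right (hu k) (step_le_one _ _)
      rw [hb, div_mul_cancel₀ _ hγ1.ne']
      have := exp_chord (x := -1) (y := 0) ha0 ha1
      rw [Real.exp_zero] at this
      calc _ = Real.exp (-1 + (∑ k, u k * step (d k) r) * (0 - -1)) := by ring_nf
        _ ≤ _ := this
        _ = _ := by ring
    · push Not at h0
      have ha : ∑ k, u k * step (d k) r = 0 := by
        refine Finset.sum_eq_zero fun k _ => ?_
        rcases lt_or_ge r (d k) with h | h
        · rw [h0 k h, zero_mul]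
        · rw [step_of_le h, mul_zero]
      have hb1 : ∑ k, (w k - u k) * step (d k) r ≤ γ - 1 := by
        rw [← hw.sum_eq, ← hu1, ← Finset.sum_sub_distrib]
        exact Finset.sum_le_sum fun k _ =>
          mul_le_of_le_one_right (sub_nonneg.2 (hw.ge k)) (step_le_one _ _)
      rw [ha]
      generalize ∑ k, (w k - u k) * step (d k) r = b at *
      have := exp_chord (x := -γ) (y := -1) (div_nonneg hb0 hγ1.le) ((div_le_one hγ1).2 hb1)
      have h2 : b / (γ - 1) * (-1 - -γ) = b := by field_simp; ring
      rw [h2] at this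
      calc _ = Real.exp (-γ + b) := by ring_nf
        _ ≤ _ := this
        _ = _ := by ring
  · rw [step_of_le hr, mul_zero, mul_zero, add_zero, sub_zero]
    have hE : Real.exp (-1) ≤ 1 := by rw [Real.exp_le_one_iff]; norm_num
    have hE' : Real.exp (-γ) ≤ Real.exp (-1) := by rw [Real.exp_le_exp]; linarith
    have h1 := mul_nonneg (sub_nonneg.2 hE) ha0
    have h2 := mul_nonneg (div_nonneg (sub_nonneg.2 hE') hγ1.le) hb0
    refine le_trans (hq.trans ?_) (le_add_of_nonneg_left (add_nonneg h1 h2))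
    -- Nothing of `w` lies beyond `r ≥ ρ`, so only residual copies can keep the cost above `r`.
    have h3 : ∑ k, v k * step (d k) r = ∑ k, (v k - min (v k) (w k)) * step (d k) r := by
      refine Finset.sum_congr rfl fun k _ => ?_
      rcases lt_or_ge r (d k) with h | h
      · rw [hw.empty k (hr.trans_lt h), min_eq_right (hv0 k), sub_zero]
      · rw [step_of_le h, mul_zero, mul_zero]
    rw [h3, mul_comm]
    refine mul_le_mul_of_nonneg_right ?_ (Finset.sum_nonneg fun k _ =>
      mul_nonneg (sub_nonneg.2 (min_le_left _ _)) (step_nonneg _ _))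
    rw [Real.exp_le_exp, neg_le_neg_iff, ← hw.sum_eq, ← Finset.sum_sub_distrib]
    refine Finset.sum_le_sum fun k _ => ?_
    rcases lt_or_ge r (d k) with h | h
    · rw [hw.empty k (hr.trans_lt h), min_eq_right (hv0 k), step_of_lt h]; simp
    · rw [step_of_le h, sub_zero, mul_one]
      rcases hv k with h' | h'
      · rw [h', min_eq_left (hw0 k)]; linarith [hw.le_open k]
      · rw [h', min_eq_right (hw.le_open k)]; linarith

/-- The tail of the connection cost, if the cluster lies within the nearest mass. -/
theorem tail_le_of_subset (hγ : 1 < γ) (hγ2 : γ ≤ 2)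
    (hu : ∀ k, 0 ≤ u k) (hu1 : ∑ k, u k = 1) (hnear : ∀ k k', d k < d k' → u k < yb k → u k' = 0)
    (hv0 : ∀ k, 0 ≤ v k) (hv1 : ∑ k, v k = 1)
    (hw : IsNearestMass yb d u w γ ρ) (hvw : ∀ k, v k ≤ w k)
    (hq : q ≤ (∑ k, v k * step (d k) r) *
      Real.exp (-∑ k, (yb k - v k) * (1 - step (d k) r))) :
    q ≤ (1 - Real.exp (-1)) * ∑ k, u k * step (d k) r +
      Real.exp (-1) / (γ - 1) * ∑ k, (w k - u k) * step (d k) r := by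
  have hγ1 : 0 < γ - 1 := by linarith
  have ha0 : 0 ≤ ∑ k, u k * step (d k) r :=
    Finset.sum_nonneg fun k _ => mul_nonneg (hu k) (step_nonneg _ _)
  have hβ0 : 0 ≤ ∑ k, v k * step (d k) r :=
    Finset.sum_nonneg fun k _ => mul_nonneg (hv0 k) (step_nonneg _ _)
  have hq' : q ≤ (∑ k, v k * step (d k) r) *
      Real.exp (-γ + 1 + ∑ k, u k * step (d k) r + ∑ k, (w k - u k) * step (d k) r -
        ∑ k, v k * step (d k) r) := by
    refine hq.trans (mul_le_mul_of_nonneg_left ?_ hβ0)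
    have hmass : -γ + 1 = ∑ k, (v k - w k) := by
      rw [Finset.sum_sub_distrib, hv1, hw.sum_eq]; ring
    rw [Real.exp_le_exp, hmass, ← Finset.sum_neg_distrib, ← Finset.sum_add_distrib,
      ← Finset.sum_add_distrib, ← Finset.sum_sub_distrib]
    refine Finset.sum_le_sum fun k _ => ?_
    have := mul_le_mul_of_nonneg_right (hw.le_open k) (sub_nonneg.2 (step_le_one (d k) r))
    nlinarith
  -- The same distinction as in `tail_le_of_residual`, now without a fallback term: `v` has no part
  -- outside `w`.
  by_cases h0 : ∃ k, r < d k ∧ u k ≠ 0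
  · obtain ⟨k₀, hk₀, hk₀u⟩ := h0
    have hb : ∑ k, (w k - u k) * step (d k) r = γ - 1 := by
      rw [← hw.sum_eq, ← hu1, ← Finset.sum_sub_distrib]
      refine Finset.sum_congr rfl fun k _ => ?_
      rcases lt_or_ge r (d k) with h | h
      · rw [step_of_lt h, mul_one]
      · have : u k = w k := by
          refine le_antisymm (hw.ge k) ((hw.le_open k).trans ?_)
          by_contra hc
          exact hk₀u (hnear k k₀ (h.trans_lt hk₀) (not_le.1 hc))
        rw [this]; simp
    have ha1 : ∑ k, u k * step (d k) r ≤ 1 := by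
      rw [← hu1]
      exact Finset.sum_le_sum fun k _ => mul_le_of_le_one_right (hu k) (step_le_one _ _)
    rw [hb] at hq' ⊢
    rw [div_mul_cancel₀ _ hγ1.ne']
    generalize ∑ k, v k * step (d k) r = β at *
    generalize ∑ k, u k * step (d k) r = a at *
    have h1 : β ≤ Real.exp (β - 1) := by linarith [Real.add_one_le_exp (β - 1)]
    have h2 := hq'.trans (mul_le_mul_of_nonneg_right h1 (Real.exp_pos _).le)
    rw [← Real.exp_add] at h2
    have := exp_chord (x := -1) (y := 0) ha0 ha1
    rw [Real.exp_zero] at this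
    have h3 : β - 1 + (-γ + 1 + a + (γ - 1) - β) = -1 + a * (0 - -1) := by ring
    rw [h3] at h2
    linarith
  · push Not at h0
    have ha : ∑ k, u k * step (d k) r = 0 := by
      refine Finset.sum_eq_zero fun k _ => ?_
      rcases lt_or_ge r (d k) with h | h
      · rw [h0 k h, zero_mul]
      · rw [step_of_le h, mul_zero]
    have hb1 : ∑ k, (w k - u k) * step (d k) r ≤ γ - 1 := by
      rw [← hw.sum_eq, ← hu1, ← Finset.sum_sub_distrib]
      exact Finset.sum_le_sum fun k _ =>
        mul_le_of_le_one_right (sub_nonneg.2 (hw.ge k)) (step_le_one _ _)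
    have hβb : ∑ k, v k * step (d k) r ≤ ∑ k, (w k - u k) * step (d k) r := by
      refine Finset.sum_le_sum fun k _ => ?_
      rcases lt_or_ge r (d k) with h | h
      · rw [h0 k h, sub_zero]
        exact mul_le_mul_of_nonneg_right (hvw k) (step_nonneg _ _)
      · rw [step_of_le h, mul_zero, mul_zero]
    rw [ha] at hq' ⊢
    rw [mul_zero, zero_add]
    generalize ∑ k, v k * step (d k) r = β at *
    generalize ∑ k, (w k - u k) * step (d k) r = b at *
    -- From `e^(β - b) ≥ 1 + β - b` the claim reduces to `(b - β) (1 - b) ≥ 0`, where `b ≤ γ - 1 ≤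
    -- 1`.
    have h1 : β * Real.exp (b - β) ≤ b := by
      have h2 : β ≤ b * Real.exp (β - b) := by
        have := mul_le_mul_of_nonneg_left (Real.add_one_le_exp (β - b)) (hβ0.trans hβb)
        nlinarith
      have h3 := mul_le_mul_of_nonneg_right h2 (Real.exp_pos (b - β)).le
      rwa [mul_assoc, ← Real.exp_add, show β - b + (b - β) = 0 by ring, Real.exp_zero,
        mul_one] at h3
    have h2 : Real.exp (1 - γ) ≤ Real.exp (-1) / (γ - 1) := by
      rw [le_div_iff₀ hγ1]
      have h3 : γ - 1 ≤ Real.exp (γ - 2) := by linarith [Real.add_one_le_exp (γ - 2)]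
      have := mul_le_mul_of_nonneg_left h3 (Real.exp_pos (1 - γ)).le
      rwa [← Real.exp_add, show 1 - γ + (γ - 2) = -1 by ring] at this
    calc q ≤ β * Real.exp (-γ + 1 + 0 + b - β) := hq'
      _ = (β * Real.exp (b - β)) * Real.exp (1 - γ) := by
        rw [mul_assoc, ← Real.exp_add]; ring_nf
      _ ≤ b * (Real.exp (-1) / (γ - 1)) :=
        mul_le_mul h1 h2 (Real.exp_pos _).le (hβ0.trans hβb)
      _ = _ := mul_comm _ _

end Tail

/-! ### The expected connection cost. -/

namespace CSRun

variable {F C X K : Type*} [Fintype F] [Fintype C] [PseudoMetricSpace X] [Fintype K]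
  {I : MetricInstance F C X} {γ : ℝ} {y : F → ℝ}

theorem sum_yb (R : CSRun I γ y K) : ∑ k, R.yb k = γ * ∑ i, y i := by
  classical
  rw [← Finset.sum_fiberwise Finset.univ R.orig, Finset.mul_sum]
  exact Finset.sum_congr rfl fun i _ => by convert R.splitting.sum_open i

/-- If a copy is not fully used by `j`, neither is its facility, so strictly farther facilities are
unused. The comparison of distances is strict because the ordering may break ties arbitrarily. -/
theorem xb_eq_zero_of_conn_lt (R : CSRun I γ y K) (j : C) (k k' : K)
    (h : I.conn (R.orig k) j < I.conn (R.orig k') j) (hk : R.xb k j < R.yb k) :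
    R.xb k' j = 0 := by
  classical
  obtain ⟨r, hr, hfill⟩ := R.xt_closest.closest j
  have hlt : R.xt (R.orig k) j < γ * y (R.orig k) := by
    have h1 := R.splitting.sum_open (R.orig k)
    rw [← R.splitting.sum_assign (R.orig k) j, ← h1]
    exact Finset.sum_lt_sum (fun k _ => R.xb_le_yb k j) ⟨k, by simp, hk⟩
  have hrr : r (R.orig k) < r (R.orig k') := by
    rcases lt_trichotomy (r (R.orig k)) (r (R.orig k')) with h' | h' | h'
    · exact h'
    · rw [r.injective h'] at h
      exact absurd h (lt_irrefl _)
    · exact absurd (hr _ _ h') h.not_ge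
  have h0 := hfill _ _ hrr hlt
  rw [← R.splitting.sum_assign (R.orig k') j,
    Finset.sum_eq_zero_iff_of_nonneg fun k _ => R.xb_nonneg k j] at h0
  exact h0 k' (by simp)

/-- The average distance of client `j` to the copies that serve it. -/
def avgDist (R : CSRun I γ y K) (j : C) : ℝ := ∑ k, I.conn (R.orig k) j * R.xb k j

/-- The maximum distance of client `j` to the copies that serve it. -/
def maxDist (R : CSRun I γ y K) (j : C) : ℝ :=
  sSup ((fun k => I.conn (R.orig k) j) '' {k | 0 < R.xb k j})

theorem conn_le_maxDist (R : CSRun I γ y K) {k : K} {j : C} (h : 0 < R.xb k j) :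
    I.conn (R.orig k) j ≤ R.maxDist j :=
  le_csSup (Set.toFinite _).bddAbove ⟨k, h, rfl⟩

theorem exists_conn_eq_maxDist (R : CSRun I γ y K) (j : C) :
    ∃ k, 0 < R.xb k j ∧ I.conn (R.orig k) j = R.maxDist j := by
  obtain ⟨k, hk⟩ := R.exists_xb_pos j
  exact Set.Nonempty.csSup_mem (s := (fun k => I.conn (R.orig k) j) '' {k | 0 < R.xb k j})
    ⟨_, k, hk, rfl⟩ (Set.toFinite _)

theorem avgDist_le_maxDist (R : CSRun I γ y K) (j : C) : R.avgDist j ≤ R.maxDist j := by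
  rw [← one_mul (R.maxDist j), ← R.sum_xb j, Finset.sum_mul]
  refine Finset.sum_le_sum fun k _ => ?_
  rcases (R.xb_nonneg k j).eq_or_lt with h | h
  · simp [← h]
  · rw [mul_comm]
    exact mul_le_mul_of_nonneg_left (R.conn_le_maxDist h) h.le

theorem exists_neighbor_center (R : CSRun I γ y K) (j : C) :
    ∃ t, (∃ k, 0 < R.xb k (R.centers.get t) ∧ 0 < R.xb k j) ∧
      R.avgDist (R.centers.get t) + R.maxDist (R.centers.get t) ≤
        R.avgDist j + R.maxDist j := by
  obtain ⟨j', hj', hs, hle⟩ := R.clustering.exists_center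
    (fun j => (R.exists_xb_pos j).imp fun k h => ⟨h, h⟩) j (Set.mem_univ j)
  obtain ⟨t, rfl⟩ := List.mem_iff_get.1 hj'
  exact ⟨t, hs, hle⟩

theorem expect_connCost_nonneg (R : CSRun I γ y K) (j : C) :
    0 ≤ R.expect (fun ω => R.connCost ω j) :=
  Finset.sum_nonneg fun ω _ => mul_nonneg (R.prob_nonneg ω) (R.connCost_nonneg ω j)

theorem expect_connCost_le_of_step (R : CSRun I γ y K) (j : C) {κ : Type*} [Fintype κ]
    (c d : κ → ℝ) (hd : ∀ k, 0 ≤ d k)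
    (h : ∀ r, 0 ≤ r →
      R.expect (fun ω => step (R.connCost ω j) r) ≤ ∑ k, c k * step (d k) r) :
    R.expect (fun ω => R.connCost ω j) ≤ ∑ k, c k * d k := by
  classical
  exact sum_mul_le_sum_mul_of_step _ _ c d (fun ω => R.connCost_nonneg ω j) hd h

theorem exists_isNearestMass (R : CSRun I γ y K) (hγ : 1 ≤ γ) {x : F → C → ℝ}
    (hxy : IsFeasible x y) (j : C) : ∃ w ρ, 0 ≤ ρ ∧
      IsNearestMass R.yb (fun k => I.conn (R.orig k) j) (fun k => R.xb k j) w γ ρ := by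
  refine UFL.exists_isNearestMass (by linarith) (fun k => dist_nonneg) R.splitting.nonneg
    (fun k => R.xb_nonneg k j) (fun k => R.xb_le_yb k j) ((R.sum_xb j).trans_le hγ) ?_
    (R.xb_eq_zero_of_conn_lt j)
  rw [R.sum_yb]
  have : 1 ≤ ∑ i, y i := by
    rw [← hxy.sum_eq_one j]
    exact Finset.sum_le_sum fun i _ => hxy.le_open i j
  nlinarith

/-- The nearest copies are at least as close as any feasible fractional assignment. -/
theorem sum_nearestMass_mul_le (R : CSRun I γ y K) (hγ : 0 ≤ γ) {x : F → C → ℝ}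
    (hxy : IsFeasible x y) {j : C} {w : K → ℝ} {ρ : ℝ}
    (hw : IsNearestMass R.yb (fun k => I.conn (R.orig k) j) (fun k => R.xb k j) w γ ρ) :
    ∑ k, w k * I.conn (R.orig k) j ≤ γ * I.fracConn x j := by
  classical
  -- Exchange argument: both sides have total value `γ`, so subtracting `ρ` changes nothing. Nearer
  -- than `ρ`, `w` is the full opening value, at least `γ * x`, and the weight is negative; farther
  -- away `w` vanishes.
  have h1 : ∑ k, w k * (I.conn (R.orig k) j - ρ) ≤ ∑ i, γ * x i j * (I.conn i j - ρ) := by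
    rw [← Finset.sum_fiberwise Finset.univ R.orig]
    refine Finset.sum_le_sum fun i _ => ?_
    have hx := mul_nonneg hγ (hxy.assign_nonneg i j)
    have hxy' := mul_le_mul_of_nonneg_left (hxy.le_open i j) hγ
    rcases lt_or_ge (I.conn i j) ρ with h | h
    · have : ∑ k with R.orig k = i, w k * (I.conn (R.orig k) j - ρ) =
          γ * y i * (I.conn i j - ρ) := by
        have h2 := R.splitting.sum_open i
        rw [← h2, Finset.sum_mul]
        refine Finset.sum_congr (by ext; simp) fun k hk => ?_
        have hk := (Finset.mem_filter.1 hk).2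
        rw [hw.full k (by rw [hk]; exact h), hk]
      rw [this]
      exact mul_le_mul_of_nonpos_right hxy' (sub_nonpos.2 h.le)
    · refine le_trans (Finset.sum_nonpos fun k hk => ?_) (mul_nonneg hx (sub_nonneg.2 h))
      have hk := (Finset.mem_filter.1 hk).2
      rcases h.eq_or_lt with h' | h'
      · rw [hk, ← h', sub_self, mul_zero]
      · rw [hw.empty k (by rw [hk]; exact h'), zero_mul]
  simp only [mul_sub, Finset.sum_sub_distrib, ← Finset.sum_mul, hw.sum_eq] at h1
  rw [← Finset.mul_sum, hxy.sum_eq_one j, mul_one] at h1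
  rw [MetricInstance.fracConn, Finset.mul_sum]
  calc _ ≤ ∑ i, γ * x i j * I.conn i j := by linarith
    _ = _ := Finset.sum_congr rfl fun i _ => by ring

/-- The expected connection cost in terms of the average distance `A` to the nearest copies of total
value `1` and the average distance `D` to the next ones of total value `γ - 1`. -/
theorem expect_connCost_le_avg (R : CSRun I γ y K) (hγ : 1 < γ) (hγ2 : γ ≤ 2) {x : F → C → ℝ}
    (hxy : IsFeasible x y) (j : C) : ∃ A D, 0 ≤ A ∧ A ≤ D ∧ A + (γ - 1) * D ≤ γ * I.fracConn x j ∧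
      R.expect (fun ω => R.connCost ω j) ≤
        (1 - Real.exp (-1) + Real.exp (-γ)) * A + (Real.exp (-1) + Real.exp (-γ)) * D := by
  have hγ1 : 0 < γ - 1 := by linarith
  obtain ⟨w, ρ, hρ, hw⟩ := R.exists_isNearestMass hγ.le hxy j
  obtain ⟨t, hshare, hscore⟩ := R.exists_neighbor_center j
  have htail := R.expect_step_le j t
  set j' := R.centers.get t
  set d : K → ℝ := fun k => I.conn (R.orig k) j with hd
  set D := (∑ k, (w k - R.xb k j) * d k) / (γ - 1) with hD
  have hD' : (γ - 1) * D = ∑ k, (w k - R.xb k j) * d k := mul_div_cancel₀ _ hγ1.ne'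
  have hd0 : ∀ k, 0 ≤ d k := fun k => dist_nonneg
  have hA : ∑ k, R.xb k j * d k = R.avgDist j := Finset.sum_congr rfl fun k _ => mul_comm _ _
  have hA' : ∑ k, R.xb k j' * I.conn (R.orig k) j' = R.avgDist j' :=
    Finset.sum_congr rfl fun k _ => mul_comm _ _
  have hnear := R.xb_eq_zero_of_conn_lt j
  have hfar : ∀ k, R.xb k j < w k → R.maxDist j ≤ d k := by
    intro k hk
    obtain ⟨k', hk', he⟩ := R.exists_conn_eq_maxDist j
    by_contra hc
    rw [← he] at hc
    exact hk'.ne' (hnear k k' (not_le.1 hc) (hk.trans_le (hw.le_open k)))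
  have hmD : R.maxDist j ≤ D := by
    refine le_of_mul_le_mul_left ?_ hγ1
    rw [hD']
    have h1 : γ - 1 = ∑ k, (w k - R.xb k j) := by
      rw [Finset.sum_sub_distrib, hw.sum_eq, R.sum_xb]
    rw [h1, Finset.sum_mul]
    refine Finset.sum_le_sum fun k _ => ?_
    rcases (hw.ge k).eq_or_lt with h | h
    · simp [h]
    · exact mul_le_mul_of_nonneg_left (hfar k h) (sub_nonneg.2 h.le)
  have hAm := R.avgDist_le_maxDist j
  have hres := sum_residual_mul_le (yb := R.yb) (u := fun k => R.xb k j) (v := fun k => R.xb k j')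
    (w := w) (d := d) (d' := fun k => I.conn (R.orig k) j')
    (δ := dist (I.clientLoc j) (I.clientLoc j')) (m := R.maxDist j) (m' := R.maxDist j') (D := D)
    hγ2 R.splitting.nonneg (fun k => R.splitting.complete k j) (fun k => R.splitting.complete k j')
    hw.ge hw.le_open (R.sum_xb j) (R.sum_xb j') hw.sum_eq
    (fun k => by
      simp only [hd, MetricInstance.conn]
      have := dist_triangle (I.facilityLoc (R.orig k)) (I.clientLoc j') (I.clientLoc j)
      rw [dist_comm (I.clientLoc j')] at this
      linarith)
    (fun k => by
      simp only [hd, MetricInstance.conn]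
      have := dist_triangle (I.clientLoc j) (I.facilityLoc (R.orig k)) (I.clientLoc j')
      rw [dist_comm (I.clientLoc j) (I.facilityLoc _)] at this
      linarith)
    (fun k => R.conn_le_maxDist) hfar (fun k => R.conn_le_maxDist) hD' hmD
    (hshare.imp fun k h => h.symm)
  rw [hA'] at hres
  have hA0 : 0 ≤ R.avgDist j :=
    Finset.sum_nonneg fun k _ => mul_nonneg (hd0 k) (R.xb_nonneg k j)
  refine ⟨R.avgDist j, D, hA0, hAm.trans hmD, ?_, ?_⟩
  · refine le_trans (le_of_eq ?_) (R.sum_nearestMass_mul_le (by linarith) hxy hw)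
    rw [hD', ← hA, ← Finset.sum_add_distrib]
    exact Finset.sum_congr rfl fun k _ => by ring
  have hz : ∑ k, (R.xb k j' - min (R.xb k j') (w k)) = 1 - ∑ k, min (R.xb k j') (w k) := by
    rw [Finset.sum_sub_distrib, R.sum_xb]
  have hZ0 : ∀ k, 0 ≤ R.xb k j' - min (R.xb k j') (w k) := fun k => sub_nonneg.2 (min_le_left _ _)
  have hz0 := Finset.sum_nonneg fun k (_ : k ∈ Finset.univ) => hZ0 k
  rcases le_or_gt ρ (D + R.maxDist j' + R.avgDist j') with hcase | hcase
  · set ε := Real.exp (-(γ - ∑ k, min (R.xb k j') (w k))) with hε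
    -- The extra index `none` is a fictitious copy at distance `ρ`; it carries the part of `e^(-γ)`
    -- that the residual copies leave over.
    have h := R.expect_connCost_le_of_step j
      (fun o : Option K => o.elim
        (Real.exp (-γ) - ε * (1 - ∑ k, min (R.xb k j') (w k)))
        (fun k => (1 - Real.exp (-1)) * R.xb k j +
          (Real.exp (-1) - Real.exp (-γ)) / (γ - 1) * (w k - R.xb k j) +
          ε * (R.xb k j' - min (R.xb k j') (w k))))
      (fun o => o.elim ρ d) (by rintro (_ | k); exacts [hρ, hd0 k]) (by
        intro r _
        refine (tail_le_of_residual R.splitting.nonneg hγ (fun k => R.xb_nonneg k j) (R.sum_xb j)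
          hnear (fun k => R.splitting.complete k j') (R.sum_xb j') hw (htail r)).trans
          (le_of_eq ?_)
        rw [Fintype.sum_option]
        simp only [Option.elim, add_mul, Finset.sum_add_distrib, mul_assoc, ← Finset.mul_sum,
          sub_mul (Real.exp (-γ))]
        ring)
    refine h.trans ?_
    rw [Fintype.sum_option]
    simp only [Option.elim, add_mul, Finset.sum_add_distrib, mul_assoc, ← Finset.mul_sum]
    have hDc : (Real.exp (-1) - Real.exp (-γ)) / (γ - 1) * ∑ k, (w k - R.xb k j) * d k =
        (Real.exp (-1) - Real.exp (-γ)) * D := by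
      rw [← hD']; field_simp
    rw [hDc, hA]
    have hε0 : 0 < ε := Real.exp_pos _
    rw [hz] at hres hz0
    -- With residual mass `z`, this is `z ≤ e^(z - 1)`. Hence `ρ` has a nonnegative coefficient and
    -- can be replaced by its upper bound in this case.
    have hεz : ε * (1 - ∑ k, min (R.xb k j') (w k)) ≤ Real.exp (-γ) := by
      have h1 := mul_le_mul_of_nonneg_left
        (Real.add_one_le_exp (-∑ k, min (R.xb k j') (w k))) hε0.le
      rw [hε, ← Real.exp_add] at h1
      rw [hε]
      calc _ = _ := by rw [sub_eq_neg_add (1 : ℝ)]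
        _ ≤ _ := h1
        _ = _ := by ring_nf
    have h2 := mul_le_mul_of_nonneg_left hres hε0.le
    have h3 := mul_le_mul_of_nonneg_left hcase (sub_nonneg.2 hεz)
    have h4 : D + R.maxDist j' + R.avgDist j' ≤ 2 * D + R.avgDist j := by linarith
    have h5 := mul_le_mul_of_nonneg_left h4 (Real.exp_pos (-γ)).le
    linarith
  -- Residual copies are at distance at least `ρ`, yet on average at most `D + m' + a' < ρ`; so
  -- there are none.
  · have hzρ : (∑ k, (R.xb k j' - min (R.xb k j') (w k))) * ρ ≤
        ∑ k, (R.xb k j' - min (R.xb k j') (w k)) * d k := by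
      rw [Finset.sum_mul]
      refine Finset.sum_le_sum fun k _ => ?_
      rcases lt_or_ge (d k) ρ with h | h
      · rw [hw.full k h, min_eq_left (R.xb_le_yb k j'), sub_self, zero_mul, zero_mul]
      · exact mul_le_mul_of_nonneg_left h (hZ0 k)
    have hz' : ∑ k, (R.xb k j' - min (R.xb k j') (w k)) = 0 := by
      refine le_antisymm (not_lt.1 fun hpos => ?_) hz0
      have := mul_lt_mul_of_pos_left hcase hpos
      linarith
    have hvw : ∀ k, R.xb k j' ≤ w k := fun k => by
      have := (Finset.sum_eq_zero_iff_of_nonneg fun k _ => hZ0 k).1 hz' k (Finset.mem_univ k)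
      rw [sub_eq_zero.1 this]
      exact min_le_right _ _
    have h := R.expect_connCost_le_of_step j
      (fun k => (1 - Real.exp (-1)) * R.xb k j +
          Real.exp (-1) / (γ - 1) * (w k - R.xb k j)) d hd0 (by
        intro r _
        refine (tail_le_of_subset hγ hγ2 (fun k => R.xb_nonneg k j) (R.sum_xb j)
          hnear (fun k => R.xb_nonneg k j') (R.sum_xb j') hw hvw (htail r)).trans
          (le_of_eq ?_)
        simp only [hd, add_mul, Finset.sum_add_distrib, mul_assoc, ← Finset.mul_sum])
    refine h.trans ?_
    simp only [add_mul, Finset.sum_add_distrib, mul_assoc, ← Finset.mul_sum]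
    have hDc : Real.exp (-1) / (γ - 1) * ∑ k, (w k - R.xb k j) * d k = Real.exp (-1) * D := by
      rw [← hD']; field_simp
    have h1 := mul_nonneg (Real.exp_pos (-γ)).le hA0
    have h2 := mul_nonneg (Real.exp_pos (-γ)).le (hA0.trans (hAm.trans hmD))
    rw [hDc, hA]
    linarith

theorem expect_connCost_le (R : CSRun I γ y K) (hγ : 1 < γ) (hγ2 : γ ≤ 2) {x : F → C → ℝ}
    (hxy : IsFeasible x y) (j : C) : R.expect (fun ω => R.connCost ω j) ≤
      max (1 + 2 * Real.exp (-γ)) ((Real.exp (-1) + Real.exp (-γ)) / (1 - 1 / γ)) *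
        I.fracConn x j := by
  obtain ⟨A, D, hA0, hAD, hC, hE⟩ := R.expect_connCost_le_avg hγ hγ2 hxy j
  have hγ0 : 0 < γ := by linarith
  have h1 : 0 < 1 - 1 / γ := by
    rw [sub_pos, div_lt_one hγ0]; exact hγ
  have hl := le_max_left (1 + 2 * Real.exp (-γ)) ((Real.exp (-1) + Real.exp (-γ)) / (1 - 1 / γ))
  have hr := le_max_right (1 + 2 * Real.exp (-γ)) ((Real.exp (-1) + Real.exp (-γ)) / (1 - 1 / γ))
  set l := max (1 + 2 * Real.exp (-γ)) ((Real.exp (-1) + Real.exp (-γ)) / (1 - 1 / γ))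
  rw [div_le_iff₀ h1] at hr
  have hl0 : 0 ≤ l := by linarith [Real.exp_pos (-γ)]
  have hC' : A + (1 - 1 / γ) * (D - A) ≤ I.fracConn x j := by
    refine le_of_mul_le_mul_left (le_trans (le_of_eq ?_) hC) hγ0
    field_simp
    ring
  have h2 := mul_le_mul_of_nonneg_left hC' hl0
  have h3 := mul_le_mul_of_nonneg_right hl hA0
  have h4 := mul_le_mul_of_nonneg_right hr (sub_nonneg.2 hAD)
  linarith

/-- All copies serving `j` are at distance zero, so `j` has score zero and so does the neighboring
center. Its cluster is then at distance zero from it, and it is at distance zero from `j`. This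
settles the convention `∞ * 0 = 0` for `γ = 1`. -/
theorem expect_connCost_eq_zero (R : CSRun I γ y K) (hγ : 1 ≤ γ) {x : F → C → ℝ}
    (hxy : IsFeasible x y) {j : C} (hC : I.fracConn x j ≤ 0) :
    R.expect (fun ω => R.connCost ω j) = 0 := by
  obtain ⟨w, ρ, -, hw⟩ := R.exists_isNearestMass hγ hxy j
  obtain ⟨t, ⟨k₀, hk₀', hk₀⟩, hscore⟩ := R.exists_neighbor_center j
  have hd0 : ∀ k c, 0 ≤ I.conn (R.orig k) c := fun k c => dist_nonneg
  have hw0 : ∀ k, 0 ≤ w k := fun k => (R.xb_nonneg k j).trans (hw.ge k)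
  have hsum : ∑ k, w k * I.conn (R.orig k) j = 0 := by
    refine le_antisymm ((R.sum_nearestMass_mul_le (by linarith) hxy hw).trans ?_)
      (Finset.sum_nonneg fun k _ => mul_nonneg (hw0 k) (hd0 k j))
    nlinarith
  have hz : ∀ k, 0 < R.xb k j → I.conn (R.orig k) j = 0 := fun k hk =>
    (mul_eq_zero.1 ((Finset.sum_eq_zero_iff_of_nonneg fun k _ => mul_nonneg (hw0 k) (hd0 k j)).1
      hsum k (Finset.mem_univ k))).resolve_left (hk.trans_le (hw.ge k)).ne'
  have hmax : R.maxDist j = 0 := by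
    obtain ⟨k, hk, he⟩ := R.exists_conn_eq_maxDist j
    rw [← he, hz k hk]
  have havg := R.avgDist_le_maxDist j
  have havg' : 0 ≤ R.avgDist (R.centers.get t) :=
    Finset.sum_nonneg fun k _ => mul_nonneg (hd0 k _) (R.xb_nonneg k _)
  have hmax' : R.maxDist (R.centers.get t) ≤ 0 := by linarith
  have hcl : dist (I.clientLoc (R.centers.get t)) (I.clientLoc j) ≤ 0 := by
    refine (dist_triangle _ (I.facilityLoc (R.orig k₀)) _).trans ?_
    rw [dist_comm (I.clientLoc (R.centers.get t))]
    exact add_nonpos ((R.conn_le_maxDist hk₀').trans hmax') (hz k₀ hk₀).le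
  refine le_antisymm ?_ (R.expect_connCost_nonneg j)
  refine (R.expect_mono (Z' := fun _ => 0) fun ω hω => ?_).trans (by simp [expect])
  refine (R.connCost_le j (Or.inl ⟨t, rfl⟩ : R.IsOpened ω (ω.1 t))).trans ?_
  refine (dist_triangle _ (I.clientLoc (R.centers.get t)) _).trans ?_
  exact add_nonpos ((R.conn_le_maxDist (R.inCluster_of_prob_ne_zero hω t)).trans hmax') hcl

theorem ofReal_expect_connCost_le (R : CSRun I γ y K) (hγ : 1 ≤ γ) (hγ2 : γ ≤ 2)
    {x : F → C → ℝ} (hxy : IsFeasible x y) (j : C) :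
    ENNReal.ofReal (R.expect fun ω => R.connCost ω j) ≤
      connFactor γ * ENNReal.ofReal (I.fracConn x j) := by
  rcases le_or_gt (I.fracConn x j) 0 with hC | hC
  · rw [R.expect_connCost_eq_zero hγ hxy hC]
    simp
  rcases hγ.eq_or_lt with rfl | hγ'
  · have h0 : connFactor 1 = ⊤ := by
      unfold connFactor
      have : ENNReal.ofReal (Real.exp (-1) + Real.exp (-1)) ≠ 0 := by
        rw [Ne, ENNReal.ofReal_eq_zero, not_le]; positivity
      simp [ENNReal.div_zero this]
    rw [h0, ENNReal.top_mul (by simpa using hC)]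
    exact le_top
  · have h1 : 0 < 1 - 1 / γ := by
      rw [sub_pos, div_lt_one (by linarith)]; exact hγ'
    have h2 : connFactor γ = ENNReal.ofReal
        (max (1 + 2 * Real.exp (-γ)) ((Real.exp (-1) + Real.exp (-γ)) / (1 - 1 / γ))) := by
      rw [connFactor, ENNReal.ofReal_max, ENNReal.ofReal_div_of_pos h1]
    rw [h2, ← ENNReal.ofReal_mul (le_max_of_le_left (by positivity))]
    exact ENNReal.ofReal_le_ofReal (R.expect_connCost_le hγ' hγ2 hxy j)

end CSRun
end UFL

end

/-! ### The bifactor guarantee. -/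

theorem theorem1 {F C X : Type*} [Fintype F] [Fintype C] [PseudoMetricSpace X]
    (I : UFL.MetricInstance F C X) (γ : ℝ) (hγ1 : 1 ≤ γ) (hγ2 : γ < 2)
    (x : F → C → ℝ) (y : F → ℝ) (hxy : UFL.IsFeasible x y) :
    (∃ n : ℕ, Nonempty (UFL.CSRun I γ y (Fin n))) ∧
    ∀ (K : Type*) [Fintype K] (R : UFL.CSRun I γ y K),
      (∀ i, R.expect (fun ω => R.openCost ω i) = γ * I.fracOpen y i) ∧
      (∀ j, ENNReal.ofReal (R.expect (fun ω => R.connCost ω j)) ≤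
        UFL.connFactor γ * ENNReal.ofReal (I.fracConn x j)) ∧
      R.expect (fun ω => I.solOpen (R.solution ω)) ≤ γ * ∑ i, I.fracOpen y i ∧
      ENNReal.ofReal (R.expect (fun ω => ∑ j, R.connCost ω j)) ≤
        UFL.connFactor γ * ENNReal.ofReal (∑ j, I.fracConn x j) := by
  refine ⟨UFL.exists_csRun I hγ1 hxy, fun K _ R => ⟨R.expect_openCost,
    R.ofReal_expect_connCost_le hγ1 hγ2.le hxy, ?_, ?_⟩⟩
  · refine (R.expect_mono fun ω _ => R.solOpen_le ω).trans (le_of_eq ?_)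
    rw [R.expect_sum, Finset.mul_sum]
    exact Finset.sum_congr rfl fun i _ => R.expect_openCost i
  · have hC : ∀ j ∈ Finset.univ, 0 ≤ I.fracConn x j := fun j _ =>
      Finset.sum_nonneg fun i _ => mul_nonneg dist_nonneg (hxy.assign_nonneg i j)
    rw [R.expect_sum, ENNReal.ofReal_sum_of_nonneg fun j _ => R.expect_connCost_nonneg j,
      ENNReal.ofReal_sum_of_nonneg hC, Finset.mul_sum]
    exact Finset.sum_le_sum fun j _ => R.ofReal_expect_connCost_le hγ1 hγ2.le hxy j
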